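/- Let $M$ and $M'$ be smooth (Hausdorff, second countable) manifolds, $p:M'\to M$ a submersion, $V\subset M$ a closed submanifold of codimension $k$, and $V'=p^{-1}(V)$. Fix smooth positive densities $\mu$ on $M$ and $\mu'$ on $M'$; they identify functions with distributions. A distribution on $M$ is a continuous linear form on $C_c^\infty(M)$, a smooth function $\kappa$ being identified with $f\mapsto\int_M\kappa f\,d\mu$. For $f\in C_c^\infty(M')$ let $p_!(f)\in C_c^\infty(M)$ be its integral along the fibres of $p$ with respect to the fibre density $\mu'/\mu$, i.e. $p_*(f\mu')=p_!(f)\,\mu$. For a distribution $P$ on $M$, $p^!(P)$ is the distribution on $M'$ given by $p^!(P)(f)=P(p_!(f))$. For $m\in\mathbb C$, a distribution $P$ on $M$ belongs to $\mathcal I^m(M,V)$ if it is smooth on $M\setminus V$ and if every point of $V$ has a neighbourhood with coordinates $(x,u)\in\mathbb R^d\times\mathbb R^k$ in which $V=\{u=0\}$ and in which, modulo a smooth function, $$P(f)=\frac1{(2\pi)^k}\int_{\mathbb R^d}\int_{\mathbb R^k}a(x,\xi)\Big(\int_{\mathbb R^k}e^{-i\langle u,\xi\rangle}f(x,u)\,w(x,u)\,du\Big)d\xi\,dx,\qquad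 \mu=w\,dx\,du,$$ for a classical symbol $a\sim\sum_{j\ge0}a_{m-j}$ of order $m$ ($a_{m-j}$ is smooth for $\xi\neq0$ and homogeneous of degree $m-j$ in $\xi$). $\mathcal I^m_c(M,V)$ is the subspace of those $P$ that have compact support. Let $\mathcal N_V^M=TM|_V/TV$ be the normal bundle and $\rho$ a smooth positive density on its fibres. The principal symbol $\sigma_m(P)$ is the function on $(\mathcal N_V^M)^*\setminus V$ that is equal to $r\,a_m$ in such coordinates, where $\rho=r\,|du|$. 1. $V'$ is a closed submanifold of codimension $k$ of $M'$, and the differential of $p$ induces a smooth isomorphism of vector bundles over $V'$ from the normal bundle $\mathcal N_{V'}^{M'}$ to the pull-back $p^*\mathcal N_V^M$. 2. For every distribution $P$ on $M$, the distribution $p^!(P)$ on $M'$ is well defined. Let $P\in\mathcal I^m_c(M,V)$. Then $p^!(P)\in\mathcal I^m(M',V')$, and $p^!(P)\in\mathcal I_c^m(M',V')$ if $p^{-1}(\operatorname{supp}P)$ is compact. Under the identification in 1, and with the density $p^*\rho$ on $\mathcal N_{V'}^{M'}$ (which is again smooth and positive), the principal symbol is $\sigma_m(p^!(P))=\sigma_m(P)\circ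 p$. -/

import Mathlib

open scoped Manifold ContDiff Topology
open MeasureTheory Filter Set

noncomputable section

namespace ConormalPullback

/-- The Euclidean space `ℝⁿ`. -/
abbrev Euc (n : ℕ) : Type := EuclideanSpace ℝ (Fin n)

/-! ## Test functions and distributions on a manifold -/

section Distributions

variable (n : ℕ) (M : Type*) [TopologicalSpace M] [ChartedSpace (Euc n) M]

/-- The space `C_c^∞(M)` of complex valued smooth functions with compact support. -/
def testFunctions : Submodule ℂ (M → ℂ) where
  carrier := {f | ContMDiff (𝓡 n) 𝓘(ℝ, ℂ) ∞ f ∧ HasCompactSupport f}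
  add_mem' := fun hf hg => ⟨hf.1.add hg.1, hf.2.add hg.2⟩
  zero_mem' := ⟨contMDiff_const, HasCompactSupport.zero⟩
  smul_mem' := fun c f hf => ⟨by
    have h : ContMDiff (𝓡 n) 𝓘(ℝ, ℂ) ∞ (fun x => c * f x) :=
      ContDiff.comp_contMDiff (g := fun z : ℂ => c * z) (contDiff_const.mul contDiff_id) hf.1
    exact h, hf.2.smul_left (f := fun _ => c)⟩

variable {n M}

/-- Convergence to `0` of a sequence in `C_c^∞(M)`: the supports stay in a fixed compact set and
all derivatives, read in the charts, converge to `0` uniformly on compact sets. -/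
def TendstoZero (f : ℕ → testFunctions n M) : Prop :=
  (∃ K : Set M, IsCompact K ∧ ∀ i, tsupport (f i : M → ℂ) ⊆ K) ∧
  ∀ (x : M) (j : ℕ) (C : Set (Euc n)), IsCompact C → C ⊆ (chartAt (Euc n) x).target →
    TendstoUniformlyOn
      (fun i z => iteratedFDeriv ℝ j ((f i : M → ℂ) ∘ (chartAt (Euc n) x).symm) z) 0 atTop C

variable (n M)

/-- A distribution on `M`: a linear form on `C_c^∞(M)` that is continuous. (For a linear form on
this strict inductive limit of Fréchet spaces, continuity is sequential continuity at `0`.) -/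
structure Distr where
  /-- the underlying linear form -/
  toLin : testFunctions n M →ₗ[ℂ] ℂ
  tendsto_zero : ∀ f : ℕ → testFunctions n M, TendstoZero f →
    Tendsto (fun i => toLin (f i)) atTop (𝓝 0)

variable {n M}

/-- The support of a distribution. -/
def Distr.support (P : Distr n M) : Set M :=
  {x | ∀ U ∈ 𝓝 x, ∃ f : testFunctions n M, tsupport (f : M → ℂ) ⊆ U ∧ P.toLin f ≠ 0}

end Distributions

/-! ## Charts, smooth densities -/

/-- `e` is a smooth chart of `M` with values in the normed space `F`. -/
structure IsSmoothChart (n : ℕ) {M : Type*} [TopologicalSpace M] [ChartedSpace (Euc n) M]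
    {F : Type*} [NormedAddCommGroup F] [NormedSpace ℝ F] (e : OpenPartialHomeomorph M F) :
    Prop where
  contMDiffOn : ContMDiffOn (𝓡 n) 𝓘(ℝ, F) ∞ e e.source
  contMDiffOn_symm : ContMDiffOn 𝓘(ℝ, F) (𝓡 n) ∞ e.symm e.target

/-- In the chart `e`, the measure `μ` is `w(z) dz` with `w` smooth and positive. -/
structure HasDensityInChart {M : Type*} [TopologicalSpace M] [MeasurableSpace M]
    {F : Type*} [NormedAddCommGroup F] [NormedSpace ℝ F] [MeasureSpace F]
    (μ : Measure M) (e : OpenPartialHomeomorph M F) (w : F → ℝ) : Prop where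
  contDiffOn : ContDiffOn ℝ ∞ w e.target
  pos : ∀ z ∈ e.target, 0 < w z
  map_eq : Measure.map e (μ.restrict e.source) =
    (volume.restrict e.target).withDensity (fun z => ENNReal.ofReal (w z))

/-- `μ` is (the measure of) a smooth positive density on the manifold `M`. -/
def IsSmoothDensity (n : ℕ) {M : Type*} [TopologicalSpace M] [ChartedSpace (Euc n) M]
    [MeasurableSpace M] (μ : Measure M) : Prop :=
  ∀ x : M, ∃ w : Euc n → ℝ, HasDensityInChart μ (chartAt (Euc n) x) w

/-! ## Closed submanifolds and their normal bundle -/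

section Submanifolds

variable {n : ℕ} {M : Type*} [TopologicalSpace M] [ChartedSpace (Euc n) M]

/-- A smooth chart of `M` with values in `ℝᵈ × ℝᵏ` in which `V` is the slice `ℝᵈ × {0}`. -/
structure AdaptedChart (n : ℕ) {M : Type*} [TopologicalSpace M] [ChartedSpace (Euc n) M]
    (V : Set M) (d k : ℕ) where
  /-- the chart -/
  chart : OpenPartialHomeomorph M (Euc d × Euc k)
  smooth : IsSmoothChart n chart
  mem_iff : ∀ y ∈ chart.source, y ∈ V ↔ (chart y).2 = 0

/-- `V` is a closed (embedded) submanifold of codimension `k` of `M`. -/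
def IsClosedSubmanifold (n : ℕ) {M : Type*} [TopologicalSpace M] [ChartedSpace (Euc n) M]
    (V : Set M) (k : ℕ) : Prop :=
  IsClosed V ∧ ∀ y ∈ V, ∃ (d : ℕ) (e : AdaptedChart n V d k), y ∈ e.chart.source

/-- The tangent space `T_yV ⊆ T_yM`: the vectors that are killed by the differentials at `y` of
the smooth functions that vanish on `V` near `y`. -/
def tangentSubspace (n : ℕ) {M : Type*} [TopologicalSpace M] [ChartedSpace (Euc n) M]
    (V : Set M) (y : M) : Submodule ℝ (TangentSpace (𝓡 n) y) where
  carrier := {v | ∀ f : M → ℝ, ContMDiffAt (𝓡 n) 𝓘(ℝ, ℝ) ∞ f y → (∀ᶠ z in 𝓝[V] y, f z = 0) →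
    mfderiv (𝓡 n) 𝓘(ℝ, ℝ) f y v = 0}
  add_mem' := fun hv hw f hf h0 => by rw [map_add, hv f hf h0, hw f hf h0, add_zero]
  zero_mem' := fun f _ _ => map_zero _
  smul_mem' := fun c v hv f hf h0 => by rw [map_smul, hv f hf h0, smul_zero]

/-- The normal space `N_y = T_yM / T_yV`. -/
abbrev NormalSpace (n : ℕ) {M : Type*} [TopologicalSpace M] [ChartedSpace (Euc n) M]
    (V : Set M) (y : M) : Type :=
  TangentSpace (𝓡 n) y ⧸ tangentSubspace n V y

namespace AdaptedChart

variable {V : Set M} {d k : ℕ} (e : AdaptedChart n V d k)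

/-- The second (transverse) component of the differential of an adapted chart. -/
def dNormal (y : M) : TangentSpace (𝓡 n) y →L[ℝ] Euc k :=
  (ContinuousLinearMap.snd ℝ (Euc d) (Euc k)).comp
    (mfderiv (𝓡 n) 𝓘(ℝ, Euc d × Euc k) e.chart y)

theorem mdiff : e.chart.MDifferentiable (𝓡 n) 𝓘(ℝ, Euc d × Euc k) :=
  ⟨e.smooth.contMDiffOn.mdifferentiableOn (by simp),
    e.smooth.contMDiffOn_symm.mdifferentiableOn (by simp)⟩

theorem dNormal_surjective [IsManifold (𝓡 n) ∞ M] {y : M} (hy : y ∈ e.chart.source) :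
    Function.Surjective (e.dNormal y) := by
  have : IsManifold (𝓡 n) 1 M := IsManifold.of_le (n := ∞) (by simp)
  have h1 := e.mdiff.mfderiv_surjective hy
  intro u
  obtain ⟨v, hv⟩ := h1 ((0, u) : Euc d × Euc k)
  exact ⟨v, congrArg Prod.snd hv⟩

theorem mfderiv_coord {y : M} (hy : y ∈ e.chart.source) (l : Euc d × Euc k →L[ℝ] ℝ)
    (v : TangentSpace (𝓡 n) y) :
    mfderiv (𝓡 n) 𝓘(ℝ, ℝ) (fun z => l (e.chart z)) y v =
      l (mfderiv (𝓡 n) 𝓘(ℝ, Euc d × Euc k) e.chart y v) := by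
  have h := (l.hasMFDerivAt (x := e.chart y)).comp y (e.mdiff.mdifferentiableAt hy).hasMFDerivAt
  have h2 := h.mfderiv
  exact congrArg (fun T => T v) h2

theorem tangentSubspace_eq_ker [IsManifold (𝓡 n) ∞ M] {y : M} (hy : y ∈ e.chart.source)
    (hV : y ∈ V) :
    tangentSubspace n V y = LinearMap.ker (e.dNormal y : TangentSpace (𝓡 n) y →ₗ[ℝ] Euc k) := by
  have : IsManifold (𝓡 n) 1 M := IsManifold.of_le (n := ∞) (by simp)
  have hnhds : e.chart.source ∈ 𝓝 y := e.chart.open_source.mem_nhds hy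
  ext v
  rw [LinearMap.mem_ker]
  constructor
  · intro hv
    ext i
    let l : Euc d × Euc k →L[ℝ] ℝ :=
      (EuclideanSpace.proj i : Euc k →L[ℝ] ℝ).comp (ContinuousLinearMap.snd ℝ (Euc d) (Euc k))
    have h := hv (fun z => l (e.chart z))
      (l.contDiff.contMDiff.contMDiffAt.comp y (e.smooth.contMDiffOn.contMDiffAt hnhds)) (by
        filter_upwards [self_mem_nhdsWithin, mem_nhdsWithin_of_mem_nhds hnhds] with z hz hz'
        have h0 := (e.mem_iff z hz').1 hz
        simp [l, h0])
    rw [e.mfderiv_coord hy l v] at h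
    exact h
  · intro hv f hf hf0
    set z₀ := e.chart y with hz₀
    have hz₀t : z₀ ∈ e.chart.target := e.chart.map_source hy
    have hzy : e.chart.symm z₀ = y := e.chart.left_inv hy
    set g : Euc d × Euc k → ℝ := fun z => f (e.chart.symm z) with hg
    have hfd : MDifferentiableAt (𝓡 n) 𝓘(ℝ, ℝ) f (e.chart.symm z₀) := by
      rw [hzy]; exact hf.mdifferentiableAt (by simp)
    have hgd : DifferentiableAt ℝ g z₀ :=
      (hfd.comp z₀ (e.mdiff.mdifferentiableAt_symm hz₀t)).differentiableAt
    have hfg : f =ᶠ[𝓝 y] g ∘ e.chart := by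
      filter_upwards [hnhds] with z hz
      simp [hg, e.chart.left_inv hz]
    have hcomp : mfderiv (𝓡 n) 𝓘(ℝ, ℝ) f y v =
        fderiv ℝ g z₀ (mfderiv (𝓡 n) 𝓘(ℝ, Euc d × Euc k) e.chart y v) := by
      have h := (hgd.hasFDerivAt.hasMFDerivAt).comp y
        (e.mdiff.mdifferentiableAt hy).hasMFDerivAt
      have h2 := (h.congr_of_eventuallyEq hfg).mfderiv
      exact congrArg (fun T => T v) h2
    rw [hcomp]
    set w : Euc d × Euc k := mfderiv (𝓡 n) 𝓘(ℝ, Euc d × Euc k) e.chart y v with hw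
    have hw2 : w.2 = 0 := hv
    have hz2 : z₀.2 = 0 := (e.mem_iff y hy).1 hV
    have hline : HasDerivAt (fun t : ℝ => z₀ + t • w) w 0 := by
      simpa using ((hasDerivAt_id (0 : ℝ)).smul_const w).const_add z₀
    have hz0' : z₀ + (0 : ℝ) • w = z₀ := by simp
    have hd : HasDerivAt (fun t : ℝ => g (z₀ + t • w)) (fderiv ℝ g z₀ w) 0 := by
      have hgd' : HasFDerivAt g (fderiv ℝ g z₀) (z₀ + (0 : ℝ) • w) := by
        rw [hz0']; exact hgd.hasFDerivAt
      exact hgd'.comp_hasDerivAt (0 : ℝ) hline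
    have hcont : Tendsto (fun t : ℝ => z₀ + t • w) (𝓝 0) (𝓝 z₀) := by
      have := hline.continuousAt.tendsto
      rwa [hz0'] at this
    have hzero : (fun t : ℝ => g (z₀ + t • w)) =ᶠ[𝓝 0] fun _ => (0 : ℝ) := by
      have hsymm : Tendsto e.chart.symm (𝓝 z₀) (𝓝 y) := by
        have := (e.chart.continuousAt_symm hz₀t).tendsto
        rwa [hzy] at this
      have h1 : ∀ᶠ t : ℝ in 𝓝 0, e.chart.symm (z₀ + t • w) ∈ V →
          f (e.chart.symm (z₀ + t • w)) = 0 :=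
        (hsymm.comp hcont).eventually (eventually_nhdsWithin_iff.1 hf0)
      have h2 : ∀ᶠ t : ℝ in 𝓝 0, z₀ + t • w ∈ e.chart.target :=
        hcont.eventually (e.chart.open_target.mem_nhds hz₀t)
      filter_upwards [h1, h2] with t ht1 ht2
      apply ht1
      rw [e.mem_iff _ (e.chart.map_target ht2), e.chart.right_inv ht2]
      simp [hz2, hw2]
    exact hd.unique ((hasDerivAt_const (0 : ℝ) (0 : ℝ)).congr_of_eventuallyEq hzero)

/-- The trivialisation of the normal bundle over `V ∩ e.chart.source` given by an adapted chart
`e = (e₁, e₂)`: it maps the class of `v` to `de₂(v)`. -/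
def normalTriv [IsManifold (𝓡 n) ∞ M] (y : M) (hy : y ∈ e.chart.source) (hV : y ∈ V) :
    NormalSpace n V y ≃ₗ[ℝ] Euc k :=
  (Submodule.quotEquivOfEq _ _ (e.tangentSubspace_eq_ker hy hV)).trans
    (LinearMap.quotKerEquivOfSurjective (e.dNormal y : TangentSpace (𝓡 n) y →ₗ[ℝ] Euc k)
      (e.dNormal_surjective hy))

end AdaptedChart

/-- The conormal covector `v ↦ ⟨ξ, de₂(v)⟩` with coordinates `ξ` in the adapted chart `e`. -/
def AdaptedChart.covector [IsManifold (𝓡 n) ∞ M] {V : Set M} {d k : ℕ} (e : AdaptedChart n V d k)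
    (y : M) (hy : y ∈ e.chart.source) (hV : y ∈ V) (ξ : Euc k) :
    Module.Dual ℝ (NormalSpace n V y) :=
  (innerSL ℝ ξ : Euc k →ₗ[ℝ] ℝ) ∘ₗ (e.normalTriv y hy hV).toLinearMap

/-- The volume of the frame `b` of `N_y` for the Lebesgue measure of the fibre coordinates of the
adapted chart `e`. -/
def AdaptedChart.frameVolume [IsManifold (𝓡 n) ∞ M] {V : Set M} {d k : ℕ}
    (e : AdaptedChart n V d k) (y : M) (hy : y ∈ e.chart.source) (hV : y ∈ V)
    (b : Fin k → NormalSpace n V y) : ℝ :=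
  |(Matrix.of fun i j => (e.normalTriv y hy hV (b j)) i).det|

/-- `ρ` is a smooth positive density on the fibres of the normal bundle of `V`; `ρ y b` is the
volume in `N_y` of the parallelepiped spanned by `b`. -/
def IsNormalDensity (n : ℕ) {M : Type*} [TopologicalSpace M] [ChartedSpace (Euc n) M]
    [IsManifold (𝓡 n) ∞ M] (V : Set M) (k : ℕ)
    (ρ : ∀ y : V, (Fin k → NormalSpace n V (y : M)) → ℝ) : Prop :=
  ∀ y₀ : V, ∃ (d : ℕ) (e : AdaptedChart n V d k) (r : M → ℝ), (y₀ : M) ∈ e.chart.source ∧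
    ContMDiffOn (𝓡 n) 𝓘(ℝ, ℝ) ∞ r e.chart.source ∧ (∀ y ∈ e.chart.source, 0 < r y) ∧
    ∀ (y : V) (hy : (y : M) ∈ e.chart.source) (b : Fin k → NormalSpace n V (y : M)),
      ρ y b = r y * e.frameVolume y hy y.2 b

end Submanifolds

/-- A family `Φ` of linear isomorphisms from the normal spaces of `p⁻¹(V)` at `x` to those of `V`
at `p x` is a smooth isomorphism of vector bundles over `p⁻¹(V)` from the normal bundle of
`p⁻¹(V)` to the pull-back by `p` of the normal bundle of `V`: in the trivialisations, it is given
by matrices that depend smoothly on the point of `p⁻¹(V)`. -/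
def IsSmoothNormalIso {n n' : ℕ} {M M' : Type*}
    [TopologicalSpace M] [ChartedSpace (Euc n) M] [IsManifold (𝓡 n) ∞ M]
    [TopologicalSpace M'] [ChartedSpace (Euc n') M'] [IsManifold (𝓡 n') ∞ M']
    (p : M' → M) (V : Set M) (k : ℕ)
    (Φ : ∀ x : ↥(p ⁻¹' V), NormalSpace n' (p ⁻¹' V) (x : M') ≃ₗ[ℝ] NormalSpace n V (p x)) :
    Prop :=
  ∀ (d d' : ℕ) (e : AdaptedChart n V d k) (e' : AdaptedChart n' (p ⁻¹' V) d' k),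
    ∃ G : M' → (Euc k →L[ℝ] Euc k),
      ContMDiffOn (𝓡 n') 𝓘(ℝ, Euc k →L[ℝ] Euc k) ∞ G
        (p ⁻¹' V ∩ (e'.chart.source ∩ p ⁻¹' e.chart.source)) ∧
      ∀ (x : ↥(p ⁻¹' V)) (hx : (x : M') ∈ e'.chart.source) (hpx : p x ∈ e.chart.source)
        (v : NormalSpace n' (p ⁻¹' V) (x : M')),
        e.normalTriv (p x) hpx x.2 (Φ x v) = G x (e'.normalTriv x hx x.2 v)

/-! ## Classical symbols and conormal distributions -/

/-- `a` is a classical symbol of order `m` on `ℝᵈ × ℝᵏ` (a family of symbols in `ξ ∈ ℝᵏ` indexed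
by `x ∈ ℝᵈ`) with asymptotic expansion `a ∼ ∑ⱼ A j`, where `A j` is smooth off `ξ = 0` and
homogeneous of degree `m - j` in `ξ`. -/
structure IsClassicalSymbol {d k : ℕ} (m : ℂ) (a : Euc d → Euc k → ℂ)
    (A : ℕ → Euc d → Euc k → ℂ) : Prop where
  smooth : ContDiff ℝ ∞ (fun z : Euc d × Euc k => a z.1 z.2)
  smooth_term : ∀ j, ContDiffOn ℝ ∞ (fun z : Euc d × Euc k => A j z.1 z.2) {z | z.2 ≠ 0}
  homogeneous : ∀ (j : ℕ) (x : Euc d) (ξ : Euc k) (t : ℝ), ξ ≠ 0 → 0 < t →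
    A j x (t • ξ) = (t : ℂ) ^ (m - (j : ℂ)) * A j x ξ
  asymptotic : ∀ (N i l : ℕ) (K : Set (Euc d)), IsCompact K → ∃ C : ℝ, ∀ x ∈ K, ∀ ξ : Euc k,
    1 ≤ ‖ξ‖ →
    ‖iteratedFDeriv ℝ i
        (fun x' => iteratedFDeriv ℝ l (fun ξ' => a x' ξ' - ∑ j ∈ Finset.range N, A j x' ξ') ξ) x‖
      ≤ C * ‖ξ‖ ^ (m.re - (N : ℝ) - (l : ℝ))

/-- `(2π)⁻ᵏ ∫∫ a(x,ξ) F̂(x,ξ) dξ dx`, where `F̂(x,ξ) = ∫ e^{-i⟨u,ξ⟩} F(x,u) du`. -/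
def symbolPairing {d k : ℕ} (a : Euc d → Euc k → ℂ) (F : Euc d × Euc k → ℂ) : ℂ :=
  (((2 * Real.pi) ^ k : ℝ) : ℂ)⁻¹ * ∫ x : Euc d, ∫ ξ : Euc k, a x ξ *
    ∫ u : Euc k, Complex.exp (-Complex.I * (inner ℝ u ξ : ℝ)) * F (x, u)

section ConormalDistributions

variable {n : ℕ} {M : Type*} [TopologicalSpace M] [ChartedSpace (Euc n) M] [MeasurableSpace M]

/-- On the open set `U`, the distribution `P` is the smooth function `κ` (a function `κ` being
identified with the distribution `f ↦ ∫ κ f dμ`). -/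
def IsSmoothOn (μ : Measure M) (P : Distr n M) (U : Set M) (κ : M → ℂ) : Prop :=
  ContMDiffOn (𝓡 n) 𝓘(ℝ, ℂ) ∞ κ U ∧
  ∀ f : testFunctions n M, tsupport (f : M → ℂ) ⊆ U →
    P.toLin f = ∫ y, κ y * (f : M → ℂ) y ∂μ

/-- In the domain of the adapted chart `e`, the distribution `P` is the sum of the conormal
distribution with total symbol `a ∼ ∑ⱼ A j` and of a smooth function: if `μ = w(x,u) dx du` in the
chart, then `P(f) = (2π)⁻ᵏ ∫∫ a(x,ξ) (∫ e^{-i⟨u,ξ⟩} f(x,u) w(x,u) du) dξ dx + ∫ κ f dμ`. -/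
def HasTotalSymbol {V : Set M} {d k : ℕ} (m : ℂ) (μ : Measure M) (P : Distr n M)
    (e : AdaptedChart n V d k) (a : Euc d → Euc k → ℂ) (A : ℕ → Euc d → Euc k → ℂ) : Prop :=
  IsClassicalSymbol m a A ∧
  ∃ (w : Euc d × Euc k → ℝ) (κ : M → ℂ), HasDensityInChart μ e.chart w ∧
    ContMDiffOn (𝓡 n) 𝓘(ℝ, ℂ) ∞ κ e.chart.source ∧
    ∀ f : testFunctions n M, tsupport (f : M → ℂ) ⊆ e.chart.source →
      P.toLin f =
        symbolPairing a
          (e.chart.target.indicator fun z => (f : M → ℂ) (e.chart.symm z) * (w z : ℂ)) +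
        ∫ y, κ y * (f : M → ℂ) y ∂μ

/-- `P` is a (classical) conormal distribution of order `m` with respect to the closed submanifold
`V` of codimension `k`: it is smooth off `V` and, near each point of `V`, the sum of a conormal
distribution given by a classical symbol of order `m` and of a smooth function. No condition on
the support. -/
def IsConormal (m : ℂ) (μ : Measure M) (V : Set M) (k : ℕ) (P : Distr n M) : Prop :=
  (∀ x ∉ V, ∃ U κ, IsOpen U ∧ x ∈ U ∧ IsSmoothOn μ P U κ) ∧
  ∀ y₀ ∈ V, ∃ (d : ℕ) (e : AdaptedChart n V d k) (a : Euc d → Euc k → ℂ)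
    (A : ℕ → Euc d → Euc k → ℂ), y₀ ∈ e.chart.source ∧ HasTotalSymbol m μ P e a A

/-- The space `𝓘_c^m(M,V)` of conormal distributions with compact support. -/
def IsConormalC (m : ℂ) (μ : Measure M) (V : Set M) (k : ℕ) (P : Distr n M) : Prop :=
  IsConormal m μ V k P ∧ IsCompact P.support

/-- `P` is a conormal distribution of order `m` whose principal symbol is the function `σ` on the
complement of the zero section in the dual of the normal bundle (the values of `σ` on the zero
section are irrelevant). The density `ρ` on the normal bundle turns the principal symbol into a
function: if `ρ` is `r |du|` in the fibre coordinates `u` of an adapted chart, and if the total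
symbol of `P` in this chart is `a ∼ A 0 + A 1 + ⋯`, then `σ` is `r A 0`. -/
def HasPrincipalSymbol [IsManifold (𝓡 n) ∞ M] (m : ℂ) (μ : Measure M) (V : Set M) (k : ℕ)
    (ρ : ∀ y : V, (Fin k → NormalSpace n V (y : M)) → ℝ) (P : Distr n M)
    (σ : ∀ y : V, Module.Dual ℝ (NormalSpace n V (y : M)) → ℂ) : Prop :=
  (∀ x ∉ V, ∃ U κ, IsOpen U ∧ x ∈ U ∧ IsSmoothOn μ P U κ) ∧
  ∀ y₀ ∈ V, ∃ (d : ℕ) (e : AdaptedChart n V d k) (a : Euc d → Euc k → ℂ)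
    (A : ℕ → Euc d → Euc k → ℂ), y₀ ∈ e.chart.source ∧ HasTotalSymbol m μ P e a A ∧
    ∀ (y : V) (hy : (y : M) ∈ e.chart.source) (ξ : Euc k), ξ ≠ 0 →
      ∀ b : Fin k → NormalSpace n V (y : M),
        σ y (e.covector y hy y.2 ξ) * (e.frameVolume y hy y.2 b : ℂ) =
          (ρ y b : ℂ) * A 0 (e.chart y).1 ξ

end ConormalDistributions

/-! ## Pull-back by a submersion -/

section PullBack

variable {n n' : ℕ} {M M' : Type*}
  [TopologicalSpace M] [ChartedSpace (Euc n) M] [MeasurableSpace M]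
  [TopologicalSpace M'] [ChartedSpace (Euc n') M'] [MeasurableSpace M']

/-- `g = p_!(f)` is the integral of `f` along the fibres of `p`, with respect to the quotient
density `μ' / μ` on the fibres: the direct image by `p` of the density `f μ'` is `g μ`. -/
def IsFiberIntegral (μ : Measure M) (μ' : Measure M') (p : M' → M)
    (f : testFunctions n' M') (g : testFunctions n M) : Prop :=
  ∀ h : testFunctions n M,
    ∫ x, (h : M → ℂ) (p x) * (f : M' → ℂ) x ∂μ' = ∫ y, (h : M → ℂ) y * (g : M → ℂ) y ∂μ

/-- `P' = p^!(P)`, that is, `P'(f) = P(p_!(f))` for every `f ∈ C_c^∞(M')`. -/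
def IsPullback (μ : Measure M) (μ' : Measure M') (p : M' → M) (P : Distr n M)
    (P' : Distr n' M') : Prop :=
  ∀ f : testFunctions n' M', ∃ g : testFunctions n M,
    IsFiberIntegral μ μ' p f g ∧ P'.toLin f = P.toLin g

end PullBack

end ConormalPullback

end

/-! A submersion is locally a projection. Let `e = (x, u)` be a chart of `M` in which `V = {u = 0}`.
Near a point over its domain, `M'` has a chart `(x, h, u)` in which `p` forgets `h`, so `V'` is
again `{u = 0}`, with the same transverse coordinate `u`. This settles the submanifold statement.
Since `u` on `M'` is `u ∘ p`, the differential of `p` becomes the identity in the two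
trivialisations of the normal bundles.

In such charts, with `μ = w dx du` and `μ' = w' dx dh du`, the fibre integral is `p_!(f) = w⁻¹ ∫ f
w' dh` (`LocalSubmersion.exists_fiberIntegral`). Partitions of unity make it global. It is unique
because a smooth positive density charges every nonempty open set, and it is sequentially continuous
because differentiation under the integral sign bounds all derivatives. Hence `p^!(P) = P ∘ p_!` is
a well-defined distribution.

Inserting `p_!(f)` into the oscillatory integral of `P` cancels the factor `w`. Fubini then moves
the integral over `h` outside (`symbolPairing_partialIntegral`), which leaves the oscillatory
integral on `M'` of the same symbol, now a function of `(x, h, ξ)` that is constant in `h`. The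
smooth remainder `κ` becomes `κ ∘ p`. So total symbols are pulled back term by term
(`AdaptedLift.hasTotalSymbol`). Because the normal trivialisations agree, frame volumes and
covectors agree too, and the principal symbol is pulled back.

Conormality and the principal symbol are tested in one suitable chart near each point, so lifting
the charts that are given for `P` is enough and no invariance under changes of coordinates is
needed. Adapted charts take values in `Euc d' × Euc k`, so a linear isomorphism `S` from `Euc d ×
Euc r` to `Euc d'` is carried along, with a Haar measure `ν` on `Euc r` normalised so that `S`
preserves measures. -/

noncomputable section

namespace ConormalPullback

/-! ## Integration over the second factor of a product -/

section PartialIntegral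

variable {F : Type} [NormedAddCommGroup F] [NormedSpace ℝ F]
  {H : Type*} [NormedAddCommGroup H] [NormedSpace ℝ H] [FiniteDimensional ℝ H]
  [MeasurableSpace H] [BorelSpace H] (ν : Measure H) [IsFiniteMeasureOnCompacts ν]

omit [NormedSpace ℝ F] [NormedSpace ℝ H] [FiniteDimensional ℝ H] in
theorem integrable_slice {E : Type*} [NormedAddCommGroup E] [NormedSpace ℝ E]
    {φ : F × H → E} (hφ : Continuous φ) (hc : HasCompactSupport φ) (y : F) :
    Integrable (fun z => φ (y, z)) ν :=
  (hφ.comp (by fun_prop : Continuous fun z : H => (y, z))).integrable_of_hasCompactSupport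
    (HasCompactSupport.of_support_subset_isCompact (hc.isCompact.image continuous_snd)
      fun z hz => ⟨(y, z), subset_tsupport _ hz, rfl⟩)

omit [FiniteDimensional ℝ H] in
-- Dominated differentiation: the partial derivative is continuous with compact support, hence
-- bounded by a constant times the indicator of the compact projection of its support, uniformly in
-- `y`.
theorem hasFDerivAt_partialIntegral {E : Type*} [NormedAddCommGroup E] [NormedSpace ℝ E]
    {φ : F × H → E} (hφ : ContDiff ℝ 1 φ) (hc : HasCompactSupport φ) (y : F) :
    HasFDerivAt (fun y => ∫ z, φ (y, z) ∂ν)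
      (∫ z, (fderiv ℝ φ (y, z)).comp (ContinuousLinearMap.inl ℝ F H) ∂ν) y := by
  have hcont : Continuous (fderiv ℝ φ) := hφ.continuous_fderiv (by simp)
  have hcd : HasCompactSupport (fderiv ℝ φ) := hc.fderiv (𝕜 := ℝ)
  set ψ : F × H → F →L[ℝ] E :=
    fun w => (fderiv ℝ φ w).comp (ContinuousLinearMap.inl ℝ F H) with hψ
  have hψc : Continuous ψ := by fun_prop
  have hψs : HasCompactSupport ψ := by
    refine hcd.mono fun w hw => ?_
    contrapose! hw
    simp only [Function.mem_support, not_not] at hw ⊢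
    simp [hψ, hw]
  obtain ⟨C, hC⟩ := hψc.bounded_above_of_compact_support hψs
  set K : Set H := Prod.snd '' tsupport ψ with hK
  have hKc : IsCompact K := hψs.isCompact.image continuous_snd
  refine hasFDerivAt_integral_of_dominated_of_fderiv_le (s := univ) (F' := fun y z => ψ (y, z))
    (bound := K.indicator fun _ => C) univ_mem
    (Eventually.of_forall fun y' => (integrable_slice ν hφ.continuous hc y').1)
    (integrable_slice ν hφ.continuous hc y) (integrable_slice ν hψc hψs y).1 ?_ ?_ ?_
  · refine Eventually.of_forall fun z y' _ => ?_
    by_cases hz : z ∈ K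
    · simpa [hz] using hC (y', z)
    · have : ψ (y', z) = 0 := by
        by_contra h
        exact hz ⟨(y', z), subset_tsupport _ h, rfl⟩
      simp [this, hz]
  · exact (integrable_indicator_iff hKc.measurableSet).2
      (integrableOn_const hKc.measure_lt_top.ne)
  · refine Eventually.of_forall fun z y' _ => ?_
    have h1 : HasFDerivAt φ (fderiv ℝ φ (y', z)) (y', z) :=
      (hφ.differentiable (by simp) _).hasFDerivAt
    exact h1.comp y' (hasFDerivAt_prodMk_left y' z)

omit [FiniteDimensional ℝ H] [MeasurableSpace H] [BorelSpace H] in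
theorem hasCompactSupport_fderiv_comp_inl {E : Type*} [NormedAddCommGroup E] [NormedSpace ℝ E]
    {φ : F × H → E} (hc : HasCompactSupport φ) :
    HasCompactSupport fun w => (fderiv ℝ φ w).comp (ContinuousLinearMap.inl ℝ F H) := by
  refine (hc.fderiv (𝕜 := ℝ)).mono fun w hw => ?_
  contrapose! hw
  simp only [Function.mem_support, not_not] at hw ⊢
  simp [hw]

omit [FiniteDimensional ℝ H] in
theorem fderiv_partialIntegral {E : Type*} [NormedAddCommGroup E] [NormedSpace ℝ E]
    {φ : F × H → E} (hφ : ContDiff ℝ ∞ φ) (hc : HasCompactSupport φ) :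
    fderiv ℝ (fun y => ∫ z, φ (y, z) ∂ν) =
      fun y => ∫ z, (fderiv ℝ φ (y, z)).comp (ContinuousLinearMap.inl ℝ F H) ∂ν :=
  funext fun y => (hasFDerivAt_partialIntegral ν (hφ.of_le (by simp)) hc y).fderiv

omit [FiniteDimensional ℝ H] [MeasurableSpace H] [BorelSpace H] in
theorem contDiff_fderiv_comp_inl {E : Type*} [NormedAddCommGroup E] [NormedSpace ℝ E]
    {φ : F × H → E} (hφ : ContDiff ℝ ∞ φ) :
    ContDiff ℝ ∞ fun w => (fderiv ℝ φ w).comp (ContinuousLinearMap.inl ℝ F H) :=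
  (hφ.fderiv_right (m := ∞) (by simp)).clm_comp contDiff_const

omit [FiniteDimensional ℝ H] in
-- The derivative of a partial integral is the partial integral of a derivative with values in `F
-- →L[ℝ] E`, so the induction runs over all target spaces `E` at once. Taking `F` and `E` in `Type`
-- keeps `F →L[ℝ] E` in the same universe.
theorem contDiff_partialIntegral_nat (j : ℕ) : ∀ {E : Type} [NormedAddCommGroup E]
    [NormedSpace ℝ E] {φ : F × H → E}, ContDiff ℝ ∞ φ → HasCompactSupport φ →
    ContDiff ℝ j fun y => ∫ z, φ (y, z) ∂ν := by
  induction j with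
  | zero =>
    intro E _ _ φ hφ hc
    refine contDiff_zero.2 ?_
    exact continuous_iff_continuousAt.2 fun y =>
      (hasFDerivAt_partialIntegral ν (hφ.of_le (by simp)) hc y).continuousAt
  | succ j ih =>
    intro E _ _ φ hφ hc
    push_cast
    refine contDiff_succ_iff_fderiv.2 ⟨fun y =>
      (hasFDerivAt_partialIntegral ν (hφ.of_le (by simp)) hc y).differentiableAt, by simp, ?_⟩
    rw [fderiv_partialIntegral ν hφ hc]
    exact ih (contDiff_fderiv_comp_inl hφ) (hasCompactSupport_fderiv_comp_inl hc)

omit [FiniteDimensional ℝ H] in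
theorem contDiff_partialIntegral {E : Type} [NormedAddCommGroup E]
    [NormedSpace ℝ E] {φ : F × H → E} (hφ : ContDiff ℝ ∞ φ) (hc : HasCompactSupport φ) :
    ContDiff ℝ ∞ fun y => ∫ z, φ (y, z) ∂ν :=
  contDiff_infty.2 fun j => contDiff_partialIntegral_nat ν j hφ hc

omit [FiniteDimensional ℝ H] in
-- The bound depends on `φ` only through `B` and the fixed compact set `K`, so it is uniform along a
-- sequence with supports in a common compact set. Differentiation does not enlarge the support, so
-- `K` survives the induction.
theorem norm_iteratedFDeriv_partialIntegral_le {K : Set H} (hK : IsCompact K) (B : ℝ) (j : ℕ) :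
    ∀ {E : Type} [NormedAddCommGroup E] [NormedSpace ℝ E] {φ : F × H → E}, ContDiff ℝ ∞ φ →
    HasCompactSupport φ → (Prod.snd '' tsupport φ ⊆ K) →
    (∀ w, ‖iteratedFDeriv ℝ j φ w‖ ≤ B) →
    ∀ y, ‖iteratedFDeriv ℝ j (fun y => ∫ z, φ (y, z) ∂ν) y‖ ≤ B * ν.real K := by
  induction j with
  | zero =>
    intro E _ _ φ hφ hc hs hB y
    simp only [norm_iteratedFDeriv_zero] at hB ⊢
    have : ∫ z, φ (y, z) ∂ν = ∫ z in K, φ (y, z) ∂ν :=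
      (setIntegral_eq_integral_of_forall_compl_eq_zero fun z hz => by
        by_contra h
        exact hz (hs ⟨(y, z), subset_tsupport _ h, rfl⟩)).symm
    rw [this]
    exact norm_setIntegral_le_of_norm_le_const hK.measure_lt_top fun z _ => hB _
  | succ j ih =>
    intro E _ _ φ hφ hc hs hB y
    rw [← norm_iteratedFDeriv_fderiv, fderiv_partialIntegral ν hφ hc]
    refine ih (contDiff_fderiv_comp_inl hφ) (hasCompactSupport_fderiv_comp_inl hc) ?_ ?_ y
    · refine (image_mono ?_).trans hs
      refine closure_minimal (fun w hw => ?_) isClosed_closure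
      refine tsupport_fderiv_subset ℝ (f := φ) (subset_tsupport _ ?_)
      contrapose! hw
      simp only [Function.mem_support, not_not] at hw ⊢
      simp [hw]
    · intro w
      -- Restriction of a linear map to the first factor has norm at most `1`, so passing from the
      -- full derivative to the partial one does not worsen `B`.
      set l : ((F × H) →L[ℝ] E) →L[ℝ] (F →L[ℝ] E) :=
        (ContinuousLinearMap.compL ℝ F (F × H) E).flip (ContinuousLinearMap.inl ℝ F H) with hl
      have hl1 : ‖l‖ ≤ 1 := by
        refine ContinuousLinearMap.opNorm_le_bound _ zero_le_one fun T => ?_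
        have h2 : ‖ContinuousLinearMap.inl ℝ F H‖ ≤ 1 :=
          ContinuousLinearMap.opNorm_le_bound _ zero_le_one fun x => by simp
        calc ‖l T‖ ≤ ‖T‖ * ‖ContinuousLinearMap.inl ℝ F H‖ := T.opNorm_comp_le _
          _ ≤ ‖T‖ * 1 := by gcongr
          _ = 1 * ‖T‖ := by ring
      have h3 := l.norm_iteratedFDeriv_comp_left (f := fderiv ℝ φ) (x := w) (N := ∞) (n := j)
        (hφ.fderiv_right (m := ∞) (by simp)).contDiffAt (by exact_mod_cast le_top)
      refine h3.trans ?_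
      rw [norm_iteratedFDeriv_fderiv]
      calc ‖l‖ * ‖iteratedFDeriv ℝ (j + 1) φ w‖ ≤ 1 * B := by
            gcongr
            exact hB w
        _ = B := one_mul _

end PartialIntegral

/-! ## Sequences of smooth functions that tend to zero with all their derivatives -/

section SmoothCvg

variable {F F₁ : Type*} [NormedAddCommGroup F] [NormedSpace ℝ F]
  [NormedAddCommGroup F₁] [NormedSpace ℝ F₁]

/-- The functions `φ i` are smooth on `Ω` and tend to `0` with all their derivatives, uniformly on
the compact subsets of `Ω`. -/
structure SmoothCvg (Ω : Set F) (φ : ℕ → F → ℂ) : Prop where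
  contDiffOn : ∀ i, ContDiffOn ℝ ∞ (φ i) Ω
  eventually_le : ∀ (j : ℕ) (C : Set F), IsCompact C → C ⊆ Ω → ∀ ε > (0 : ℝ),
    ∀ᶠ i in atTop, ∀ z ∈ C, ‖iteratedFDeriv ℝ j (φ i) z‖ ≤ ε

theorem tendstoUniformlyOn_zero_iff {α E : Type*} [NormedAddCommGroup E] {g : ℕ → α → E}
    {C : Set α} :
    TendstoUniformlyOn g 0 atTop C ↔ ∀ ε > (0 : ℝ), ∀ᶠ i in atTop, ∀ z ∈ C, ‖g i z‖ ≤ ε := by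
  rw [Metric.tendstoUniformlyOn_iff]
  constructor
  · intro h ε hε
    filter_upwards [h ε hε] with i hi z hz
    have := hi z hz
    simp only [Pi.zero_apply, dist_zero_left] at this
    exact this.le
  · intro h ε hε
    filter_upwards [h (ε / 2) (half_pos hε)] with i hi z hz
    simp only [Pi.zero_apply, dist_zero_left]
    linarith [hi z hz]

namespace SmoothCvg

variable {Ω : Set F} {φ : ℕ → F → ℂ}

theorem congr (h : SmoothCvg Ω φ) (hΩ : IsOpen Ω) {ψ : ℕ → F → ℂ}
    (hψ : ∀ i, EqOn (ψ i) (φ i) Ω) : SmoothCvg Ω ψ where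
  contDiffOn i := (h.contDiffOn i).congr (hψ i)
  eventually_le j C hC hCΩ ε hε := by
    filter_upwards [h.eventually_le j C hC hCΩ ε hε] with i hi z hz
    have : ψ i =ᶠ[𝓝 z] φ i := (hψ i).eventuallyEq_of_mem (hΩ.mem_nhds (hCΩ hz))
    rw [(this.iteratedFDeriv ℝ j).self_of_nhds]
    exact hi z hz

theorem zero : SmoothCvg Ω (fun _ _ => 0) where
  contDiffOn _ := contDiffOn_const
  eventually_le j C _ _ ε hε := by
    refine Eventually.of_forall fun i z _ => ?_
    have : iteratedFDeriv ℝ j (fun _ : F => (0 : ℂ)) = 0 := iteratedFDeriv_fun_zero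
    rw [this]
    simpa using hε.le

/-- A compact set is covered by finitely many compact neighbourhoods. This allows functions extended
by zero to be treated separately on a chart domain and off a compact set containing all supports. -/
theorem of_locally [LocallyCompactSpace F]
    (h : ∀ z ∈ Ω, ∃ O, IsOpen O ∧ z ∈ O ∧ SmoothCvg O φ) : SmoothCvg Ω φ where
  contDiffOn i z hz := by
    obtain ⟨O, hO, hzO, hφ⟩ := h z hz
    exact ((hφ.contDiffOn i).contDiffAt (hO.mem_nhds hzO)).contDiffWithinAt
  eventually_le j C hC hCΩ ε hε := by
    refine hC.induction_on (p := fun C => ∀ᶠ i in atTop, ∀ z ∈ C, ‖iteratedFDeriv ℝ j (φ i) z‖ ≤ ε)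
      (by simp) ?_ ?_ ?_
    · intro s t hst ht
      filter_upwards [ht] with i hi z hz using hi z (hst hz)
    · intro s t hs ht
      filter_upwards [hs, ht] with i hi hi' z hz using hz.elim (hi z) (hi' z)
    · intro z hz
      obtain ⟨O, hO, hzO, hφ⟩ := h z (hCΩ hz)
      obtain ⟨D, hD, hzD, hDO⟩ := exists_compact_subset hO hzO
      exact ⟨D, mem_nhdsWithin_of_mem_nhds (mem_interior_iff_mem_nhds.1 hzD),
        hφ.eventually_le j D hD hDO ε hε⟩

theorem mul (h : SmoothCvg Ω φ) (hΩ : IsOpen Ω) {g : F → ℂ} (hg : ContDiffOn ℝ ∞ g Ω) :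
    SmoothCvg Ω fun i z => g z * φ i z where
  contDiffOn i := hg.mul (h.contDiffOn i)
  eventually_le j C hC hCΩ ε hε := by
    have hb : ∀ l : ℕ, ∃ B : ℝ, ∀ z ∈ C, ‖iteratedFDeriv ℝ l g z‖ ≤ B := fun l => by
      have h1 := hg.continuousOn_iteratedFDerivWithin (m := l) (by exact_mod_cast le_top)
        hΩ.uniqueDiffOn
      have h2 : ContinuousOn (iteratedFDeriv ℝ l g) C :=
        (h1.congr fun z hz => (iteratedFDerivWithin_of_isOpen l hΩ hz).symm).mono hCΩ
      exact hC.exists_bound_of_continuousOn h2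
    choose B hB using hb
    -- `S` is the Leibniz sum of the bounds for `g`; the `+ 1` keeps `ε / S` meaningful when the sum
    -- vanishes.
    set S : ℝ := ∑ l ∈ Finset.range (j + 1), (j.choose l : ℝ) * |B l| + 1 with hS
    have hS0 : 0 < S := by positivity
    have hev : ∀ᶠ i in atTop, ∀ l ∈ Finset.range (j + 1), ∀ z ∈ C,
        ‖iteratedFDeriv ℝ (j - l) (φ i) z‖ ≤ ε / S :=
      (Filter.eventually_all_finset _).2 fun l _ =>
        h.eventually_le (j - l) C hC hCΩ (ε / S) (by positivity)
    filter_upwards [hev] with i hi z hz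
    have h1 := norm_iteratedFDerivWithin_mul_le hg (h.contDiffOn i) hΩ.uniqueDiffOn (hCΩ hz)
      (n := j) (by exact_mod_cast le_top)
    rw [iteratedFDerivWithin_of_isOpen j hΩ (hCΩ hz)] at h1
    refine h1.trans ?_
    calc _ ≤ ∑ l ∈ Finset.range (j + 1), (j.choose l : ℝ) * |B l| * (ε / S) := by
          refine Finset.sum_le_sum fun l hl => ?_
          rw [iteratedFDerivWithin_of_isOpen _ hΩ (hCΩ hz),
            iteratedFDerivWithin_of_isOpen _ hΩ (hCΩ hz)]
          gcongr
          · exact (hB l z hz).trans (le_abs_self _)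
          · exact hi l hl z hz
      _ = (∑ l ∈ Finset.range (j + 1), (j.choose l : ℝ) * |B l|) * (ε / S) := by
          rw [Finset.sum_mul]
      _ ≤ S * (ε / S) := by
          gcongr
          linarith
      _ = ε := by field_simp

theorem comp (h : SmoothCvg Ω φ) (hΩ : IsOpen Ω) {O : Set F₁} (hO : IsOpen O) {ψ : F₁ → F}
    (hψ : ContDiffOn ℝ ∞ ψ O) (hm : MapsTo ψ O Ω) : SmoothCvg O fun i z => φ i (ψ z) where
  contDiffOn i := (h.contDiffOn i).comp hψ hm
  eventually_le j C hC hCΩ ε hε := by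
    have hb : ∀ l : ℕ, ∃ B : ℝ, ∀ z ∈ C, ‖iteratedFDerivWithin ℝ l ψ O z‖ ≤ B := fun l => by
      have h1 := hψ.continuousOn_iteratedFDerivWithin (m := l) (by exact_mod_cast le_top)
        hO.uniqueDiffOn
      exact hC.exists_bound_of_continuousOn (h1.mono hCΩ)
    choose B hB using hb
    -- The Faà di Bruno estimate wants the `l`-th derivative of `ψ` bounded by `D ^ l`. Since `D ≥
    -- 1`, the bound `D` itself suffices for `l ≥ 1`.
    set D : ℝ := ∑ l ∈ Finset.range (j + 1), |B l| + 1 with hD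
    have hD1 : 1 ≤ D := by
      have : 0 ≤ ∑ l ∈ Finset.range (j + 1), |B l| := by positivity
      linarith
    set S : ℝ := (j.factorial : ℝ) * D ^ j with hS
    have hS0 : 0 < S := by positivity
    have hev : ∀ᶠ i in atTop, ∀ l ∈ Finset.range (j + 1), ∀ z ∈ ψ '' C,
        ‖iteratedFDeriv ℝ l (φ i) z‖ ≤ ε / S :=
      (Filter.eventually_all_finset _).2 fun l _ =>
        h.eventually_le l _ (hC.image_of_continuousOn (hψ.continuousOn.mono hCΩ))
          (by rintro _ ⟨z, hz, rfl⟩; exact hm (hCΩ hz)) (ε / S) (by positivity)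
    filter_upwards [hev] with i hi z hz
    have h1 := norm_iteratedFDerivWithin_comp_le (h.contDiffOn i) hψ (n := j)
      (by exact_mod_cast le_top) hΩ.uniqueDiffOn hO.uniqueDiffOn hm (hCΩ hz) (C := ε / S) (D := D)
      (fun l hl => by
        rw [iteratedFDerivWithin_of_isOpen _ hΩ (hm (hCΩ hz))]
        exact hi l (Finset.mem_range_succ_iff.2 hl) _ ⟨z, hz, rfl⟩)
      (fun l hl1 hl => by
        have h2 : |B l| ≤ ∑ l ∈ Finset.range (j + 1), |B l| :=
          Finset.single_le_sum (f := fun l => |B l|) (fun _ _ => abs_nonneg _)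
            (Finset.mem_range_succ_iff.2 hl)
        calc _ ≤ |B l| := (hB l z hz).trans (le_abs_self _)
          _ ≤ D := by linarith
          _ ≤ D ^ l := le_self_pow₀ hD1 (by omega))
    rw [iteratedFDerivWithin_of_isOpen j hO (hCΩ hz)] at h1
    refine h1.trans (le_of_eq ?_)
    rw [hS]
    field_simp

end SmoothCvg

theorem SmoothCvg.partialIntegral {F : Type} [NormedAddCommGroup F] [NormedSpace ℝ F]
    {H : Type*} [NormedAddCommGroup H] [NormedSpace ℝ H] [FiniteDimensional ℝ H]
    [MeasurableSpace H] [BorelSpace H] (ν : Measure H) [IsFiniteMeasureOnCompacts ν]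
    {φ : ℕ → F × H → ℂ} (h : SmoothCvg univ φ) {K : Set (F × H)} (hK : IsCompact K)
    (hs : ∀ i, tsupport (φ i) ⊆ K) : SmoothCvg univ fun i y => ∫ z, φ i (y, z) ∂ν := by
  have hsm : ∀ i, ContDiff ℝ ∞ (φ i) := fun i => contDiffOn_univ.1 (h.contDiffOn i)
  have hcs : ∀ i, HasCompactSupport (φ i) := fun i =>
    hK.of_isClosed_subset (isClosed_tsupport _) (hs i)
  refine ⟨fun i => (contDiff_partialIntegral ν (hsm i) (hcs i)).contDiffOn, ?_⟩
  intro j C _ _ ε hε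
  set v := ν.real (Prod.snd '' K) with hv
  have hv0 : 0 ≤ v := measureReal_nonneg
  filter_upwards [h.eventually_le j K hK (subset_univ _) (ε / (v + 1)) (by positivity)] with i hi
    z _
  have h1 := norm_iteratedFDeriv_partialIntegral_le ν (hK.image continuous_snd) (ε / (v + 1)) j
    (hsm i) (hcs i) (image_mono (hs i)) (fun w => by
      by_cases hw : w ∈ K
      · exact hi w hw
      · have : iteratedFDeriv ℝ j (φ i) w = 0 := by
          by_contra h0
          exact hw (hs i (support_iteratedFDeriv_subset j h0))
        rw [this, norm_zero]
        positivity) z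
  refine h1.trans ?_
  rw [← hv, div_mul_eq_mul_div, div_le_iff₀ (by positivity)]
  nlinarith

end SmoothCvg

/-! ## Fourier transform in the fibre variables -/

section Fourier

variable {X : Type*} [NormedAddCommGroup X] [NormedSpace ℝ X] {k : ℕ}

/-- The Fourier transform `∫ e^{-i⟨u,ξ⟩} Φ(x,u) du` in the second variable. -/
def fiberFourier (Φ : X × Euc k → ℂ) (x : X) (ξ : Euc k) : ℂ :=
  ∫ u : Euc k, Complex.exp (-Complex.I * (inner ℝ u ξ : ℝ)) * Φ (x, u)

theorem norm_iteratedFDeriv_slice_le {E : Type*} [NormedAddCommGroup E] [NormedSpace ℝ E]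
    {Φ : X × Euc k → E} (hΦ : ContDiff ℝ ∞ Φ) (j : ℕ) (x : X) (u : Euc k) :
    ‖iteratedFDeriv ℝ j (fun u => Φ (x, u)) u‖ ≤ ‖iteratedFDeriv ℝ j Φ (x, u)‖ := by
  have h1 : (fun u => Φ (x, u)) =
      (fun w => Φ ((x, 0) + w)) ∘ (ContinuousLinearMap.inr ℝ X (Euc k)) := by
    ext u; simp
  have h2 : ContDiff ℝ ∞ fun w => Φ ((x, 0) + w) := hΦ.comp (contDiff_const.add contDiff_id)
  rw [h1, ContinuousLinearMap.iteratedFDeriv_comp_right _ h2 _ (by exact_mod_cast le_top),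
    iteratedFDeriv_comp_add_left]
  refine (ContinuousMultilinearMap.norm_compContinuousLinearMap_le _ _).trans ?_
  have h3 : ‖ContinuousLinearMap.inr ℝ X (Euc k)‖ ≤ 1 :=
    ContinuousLinearMap.opNorm_le_bound _ zero_le_one fun x => by simp
  have h4 : ∏ _i : Fin j, ‖ContinuousLinearMap.inr ℝ X (Euc k)‖ ≤ 1 :=
    Finset.prod_le_one (fun _ _ => norm_nonneg _) fun _ _ => h3
  calc _ ≤ ‖iteratedFDeriv ℝ j Φ ((x, 0) + ContinuousLinearMap.inr ℝ X (Euc k) u)‖ * 1 := by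
        gcongr
    _ = _ := by simp

omit [NormedAddCommGroup X] [NormedSpace ℝ X] in
-- The two normalisations differ: the kernel of `FourierTransform.fourier` is `e^{-2πi⟨u,ξ⟩}`, hence
-- the rescaling of `ξ`.
theorem fiberFourier_eq_fourier (Φ : X × Euc k → ℂ) (x : X) (ξ : Euc k) :
    fiberFourier Φ x ξ =
      FourierTransform.fourier (fun u => Φ (x, u)) ((2 * Real.pi)⁻¹ • ξ) := by
  rw [Real.fourier_eq, fiberFourier]
  congr 1
  ext u
  rw [Circle.smul_def, smul_eq_mul, Real.fourierChar_apply, inner_smul_right]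
  congr 2
  push_cast
  have : (Real.pi : ℂ) ≠ 0 := by exact_mod_cast Real.pi_ne_zero
  field_simp

/-- Rapid decay of the Fourier transform of a test function. The point is uniformity in `x`: all
slices are supported in one compact set, and their derivatives are bounded by those of `Φ`. -/
theorem exists_pow_mul_fiberFourier_le {Φ : X × Euc k → ℂ} (hΦ : ContDiff ℝ ∞ Φ)
    (hc : HasCompactSupport Φ) (n : ℕ) :
    ∃ C : ℝ, ∀ x ξ, ‖ξ‖ ^ n * ‖fiberFourier Φ x ξ‖ ≤ C := by
  have hb : ∀ j : ℕ, ∃ B : ℝ, ∀ w, ‖iteratedFDeriv ℝ j Φ w‖ ≤ B := fun j =>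
    (hΦ.continuous_iteratedFDeriv (m := j)
      (by exact_mod_cast le_top)).bounded_above_of_compact_support (hc.iteratedFDeriv j)
  choose B hB using hb
  set K : Set (Euc k) := Prod.snd '' tsupport Φ with hK
  have hKc : IsCompact K := hc.isCompact.image continuous_snd
  -- The factor `(2π)ⁿ` undoes the rescaling of `ξ`. The rest is the bound of
  -- `Real.pow_mul_norm_iteratedFDeriv_fourier_le` for the derivative of order `0`, with each
  -- integral replaced by a supremum times the volume of `K`.
  refine ⟨(2 * Real.pi) ^ n * ((2 * 0 + 2) ^ n * ∑ p ∈ Finset.range (0 + 1) ×ˢ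
    Finset.range (n + 1), B p.2 * volume.real K), fun x ξ => ?_⟩
  set f : Euc k → ℂ := fun u => Φ (x, u) with hf
  have hfs : ContDiff ℝ ∞ f := hΦ.comp (contDiff_const.prodMk contDiff_id)
  have hsub : Function.support f ⊆ K := fun u hu => ⟨(x, u), subset_tsupport _ hu, rfl⟩
  have hfc : HasCompactSupport f := HasCompactSupport.of_support_subset_isCompact hKc hsub
  have htf : tsupport f ⊆ K := closure_minimal hsub hKc.isClosed
  have hcont : ∀ j : ℕ, Continuous (iteratedFDeriv ℝ j f) := fun j =>
    hfs.continuous_iteratedFDeriv (by exact_mod_cast le_top)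
  have hmain := Real.pow_mul_norm_iteratedFDeriv_fourier_le (f := f) (K := ⊤) (N := ⊤)
    hfs (fun i j _ _ => by
      refine Continuous.integrable_of_hasCompactSupport
        ((continuous_norm.pow i).mul (hcont j).norm) ?_
      exact (hfc.iteratedFDeriv (𝕜 := ℝ) j).norm.mul_left) (k := 0) (n := n) le_top le_top
    ((2 * Real.pi)⁻¹ • ξ)
  rw [norm_iteratedFDeriv_zero, ← fiberFourier_eq_fourier, norm_smul] at hmain
  have hpi : 0 < 2 * Real.pi := by positivity
  rw [Real.norm_of_nonneg (by positivity), mul_pow, inv_pow] at hmain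
  have h2 : ‖ξ‖ ^ n * ‖fiberFourier Φ x ξ‖ =
      (2 * Real.pi) ^ n * (((2 * Real.pi) ^ n)⁻¹ * ‖ξ‖ ^ n * ‖fiberFourier Φ x ξ‖) := by
    field_simp
  rw [h2]
  refine mul_le_mul_of_nonneg_left (hmain.trans ?_) (by positivity)
  simp only [pow_zero, one_mul, Nat.cast_zero]
  refine mul_le_mul_of_nonneg_left ?_ (by positivity)
  refine Finset.sum_le_sum fun p hp => ?_
  have hp1 : p.1 = 0 := by
    have := (Finset.mem_product.1 hp).1
    simpa using this
  simp only [hp1, pow_zero, one_mul]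
  have : ∫ v, ‖iteratedFDeriv ℝ p.2 f v‖ = ∫ v in K, ‖iteratedFDeriv ℝ p.2 f v‖ :=
    (setIntegral_eq_integral_of_forall_compl_eq_zero fun v hv => by
      rw [norm_eq_zero]
      by_contra h
      exact hv (htf (support_iteratedFDeriv_subset p.2 h))).symm
  rw [this]
  refine (le_abs_self _).trans ?_
  refine norm_setIntegral_le_of_norm_le_const (f := fun v => ‖iteratedFDeriv ℝ p.2 f v‖)
    hKc.measure_lt_top fun v _ => ?_
  rw [norm_norm]
  exact (norm_iteratedFDeriv_slice_le hΦ p.2 x v).trans (hB p.2 _)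

theorem exists_one_add_pow_mul_fiberFourier_le {Φ : X × Euc k → ℂ} (hΦ : ContDiff ℝ ∞ Φ)
    (hc : HasCompactSupport Φ) (n : ℕ) :
    ∃ C : ℝ, 0 ≤ C ∧ ∀ x ξ, (1 + ‖ξ‖) ^ n * ‖fiberFourier Φ x ξ‖ ≤ C := by
  obtain ⟨C₀, h0⟩ := exists_pow_mul_fiberFourier_le hΦ hc 0
  obtain ⟨C₁, h1⟩ := exists_pow_mul_fiberFourier_le hΦ hc n
  refine ⟨2 ^ n * (|C₀| + |C₁|), by positivity, fun x ξ => ?_⟩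
  have h2 : (1 + ‖ξ‖) ^ n ≤ 2 ^ n * (1 + ‖ξ‖ ^ n) := by
    rcases le_total ‖ξ‖ 1 with h | h
    · calc (1 + ‖ξ‖) ^ n ≤ 2 ^ n := by gcongr; linarith
        _ ≤ 2 ^ n * (1 + ‖ξ‖ ^ n) := le_mul_of_one_le_right (by positivity)
            (by linarith [pow_nonneg (norm_nonneg ξ) n])
    · calc (1 + ‖ξ‖) ^ n ≤ (2 * ‖ξ‖) ^ n := by gcongr; linarith
        _ = 2 ^ n * ‖ξ‖ ^ n := mul_pow _ _ _
        _ ≤ _ := by gcongr; linarith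
  have h3 := (h0 x ξ).trans (le_abs_self C₀)
  have h4 := (h1 x ξ).trans (le_abs_self C₁)
  rw [pow_zero, one_mul] at h3
  calc _ ≤ 2 ^ n * (1 + ‖ξ‖ ^ n) * ‖fiberFourier Φ x ξ‖ := by gcongr
    _ = 2 ^ n * (‖fiberFourier Φ x ξ‖ + ‖ξ‖ ^ n * ‖fiberFourier Φ x ξ‖) := by ring
    _ ≤ _ := by gcongr

omit [NormedSpace ℝ X] in
theorem continuous_fiberFourier [LocallyCompactSpace X] {Φ : X × Euc k → ℂ} (hΦ : Continuous Φ)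
    (hc : HasCompactSupport Φ) :
    Continuous fun z : X × Euc k => fiberFourier Φ z.1 z.2 := by
  have hKc : IsCompact (Prod.snd '' tsupport Φ : Set (Euc k)) := hc.isCompact.image continuous_snd
  have h : ∀ z : X × Euc k, fiberFourier Φ z.1 z.2 = ∫ u in Prod.snd '' tsupport Φ,
      Complex.exp (-Complex.I * (inner ℝ u z.2 : ℝ)) * Φ (z.1, u) := fun z =>
    (setIntegral_eq_integral_of_forall_compl_eq_zero fun u hu => by
      have : Φ (z.1, u) = 0 := by
        by_contra h
        exact hu ⟨(z.1, u), subset_tsupport _ h, rfl⟩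
      rw [this, mul_zero]).symm
  simp only [h]
  refine continuous_parametric_integral_of_continuous (f := fun (z : X × Euc k) u =>
    Complex.exp (-Complex.I * (inner ℝ u z.2 : ℝ)) * Φ (z.1, u)) ?_ hKc
  fun_prop

omit [NormedSpace ℝ X] in
theorem fiberFourier_eq_zero {Φ : X × Euc k → ℂ} {x : X} (hx : x ∉ Prod.fst '' tsupport Φ)
    (ξ : Euc k) : fiberFourier Φ x ξ = 0 := by
  have h : ∀ u, Φ (x, u) = 0 := fun u => by
    by_contra h
    exact hx ⟨(x, u), subset_tsupport _ h, rfl⟩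
  simp [fiberFourier, h]

end Fourier

/-! ## Integration along fibres and oscillatory integrals -/

theorem symbolPairing_eq {d k : ℕ} (a : Euc d → Euc k → ℂ) (Φ : Euc d × Euc k → ℂ) :
    symbolPairing a Φ = (((2 * Real.pi) ^ k : ℝ) : ℂ)⁻¹ *
      ∫ x : Euc d, ∫ ξ : Euc k, a x ξ * fiberFourier Φ x ξ := rfl

section Fubini

variable {d d' k : ℕ} {H : Type*} [NormedAddCommGroup H] [NormedSpace ℝ H]
  [FiniteDimensional ℝ H] [MeasurableSpace H] [BorelSpace H] (ν : Measure H)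
  [IsFiniteMeasureOnCompacts ν] [SFinite ν]

theorem fiberFourier_partialIntegral (S : (Euc d × H) ≃L[ℝ] Euc d') {Φ : Euc d' × Euc k → ℂ}
    (hΦ : Continuous Φ) (hc : HasCompactSupport Φ) (x : Euc d) (ξ : Euc k) :
    fiberFourier (fun z : Euc d × Euc k => ∫ h, Φ (S (z.1, h), z.2) ∂ν) x ξ =
      ∫ h, fiberFourier Φ (S (x, h)) ξ ∂ν := by
  simp only [fiberFourier, ← integral_const_mul]
  refine integral_integral_swap (f := fun (u : Euc k) (h : H) =>
    Complex.exp (-Complex.I * (inner ℝ u ξ : ℝ)) * Φ (S (x, h), u)) ?_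
  refine Continuous.integrable_of_hasCompactSupport (by fun_prop) ?_
  refine HasCompactSupport.of_support_subset_isCompact
    ((hc.isCompact.image continuous_snd).prod
      (hc.isCompact.image (f := fun w => (S.symm w.1).2) (by fun_prop))) ?_
  rintro ⟨u, h⟩ hu
  have hu' : Φ (S (x, h), u) ≠ 0 := right_ne_zero_of_mul hu
  exact ⟨⟨_, subset_tsupport _ hu', rfl⟩, ⟨_, subset_tsupport _ hu', by simp⟩⟩

/-- The integrand in `(x, h, ξ, u)` need not be absolutely integrable, because `a` may grow in `ξ`.
Fubini is therefore used in two stages: `h` is exchanged with `u` for fixed `ξ`, where the support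
is compact, and then with `ξ`, where the Fourier transform already decays faster than `a` grows. -/
theorem symbolPairing_partialIntegral (S : (Euc d × H) ≃L[ℝ] Euc d')
    (hS : MeasurePreserving S (volume.prod ν) volume) {a : Euc d → Euc k → ℂ}
    (ha : Continuous fun z : Euc d × Euc k => a z.1 z.2)
    (hg : ∀ K : Set (Euc d), IsCompact K → ∃ (n : ℕ) (C : ℝ), ∀ x ∈ K, ∀ ξ,
      ‖a x ξ‖ ≤ C * (1 + ‖ξ‖) ^ n)
    {Φ : Euc d' × Euc k → ℂ} (hΦ : ContDiff ℝ ∞ Φ) (hc : HasCompactSupport Φ) :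
    symbolPairing a (fun z => ∫ h, Φ (S (z.1, h), z.2) ∂ν) =
      symbolPairing (fun x' => a (S.symm x').1) Φ := by
  set K : Set (Euc d × H) := (fun w : Euc d' × Euc k => S.symm w.1) '' tsupport Φ with hKdef
  have hK : IsCompact K := hc.isCompact.image (by fun_prop)
  have hzero : ∀ z ∉ K, ∀ ξ, fiberFourier Φ (S z) ξ = 0 := fun z hz ξ => by
    refine fiberFourier_eq_zero (fun ⟨w, hw, hwz⟩ => hz ⟨w, hw, ?_⟩) ξ
    change S.symm w.1 = z
    rw [hwz, S.symm_apply_apply]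
  obtain ⟨n, C₁, hC₁⟩ := hg (Prod.fst '' K) (hK.image continuous_fst)
  -- In the exponent, `n` absorbs the growth of the symbol and `k + 1` leaves an integrable weight
  -- on `Euc k`.
  obtain ⟨C₂, hC₂0, hC₂⟩ := exists_one_add_pow_mul_fiberFourier_le hΦ hc (n + (k + 1))
  set D : ℝ := |C₁| * C₂ with hD
  set Ψ : (Euc d × H) × Euc k → ℂ := fun w => a w.1.1 w.2 * fiberFourier Φ (S w.1) w.2 with hΨ
  have hΨc : Continuous Ψ := by
    have h1 := continuous_fiberFourier hΦ.continuous hc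
    have h2 : Continuous fun w : (Euc d × H) × Euc k => fiberFourier Φ (S w.1) w.2 :=
      h1.comp' (f := fun w : (Euc d × H) × Euc k => (S w.1, w.2))
        ((S.continuous.comp continuous_fst).prodMk continuous_snd)
    have h3 : Continuous fun w : (Euc d × H) × Euc k => a w.1.1 w.2 :=
      ha.comp' (f := fun w : (Euc d × H) × Euc k => (w.1.1, w.2))
        ((continuous_fst.comp continuous_fst).prodMk continuous_snd)
    exact h3.mul h2
  set q : Euc k → ℝ := fun ξ => (1 + ‖ξ‖) ^ (-((k : ℝ) + 1)) with hq
  have hqi : Integrable q := integrable_one_add_norm (by simp)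
  have hbd : ∀ z ∈ K, ∀ ξ, ‖Ψ (z, ξ)‖ ≤ D * q ξ := fun z hz ξ => by
    have h1 := hC₁ z.1 ⟨z, hz, rfl⟩ ξ
    have h2 := hC₂ (S z) ξ
    have hp : 0 < 1 + ‖ξ‖ := by positivity
    have hq' : q ξ = ((1 + ‖ξ‖) ^ (k + 1))⁻¹ := by
      rw [hq]
      simp only
      rw [Real.rpow_neg hp.le]
      congr 1
      exact_mod_cast Real.rpow_natCast (1 + ‖ξ‖) (k + 1)
    rw [hq', ← div_eq_mul_inv, le_div_iff₀ (by positivity), norm_mul]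
    calc ‖a z.1 ξ‖ * ‖fiberFourier Φ (S z) ξ‖ * (1 + ‖ξ‖) ^ (k + 1)
        ≤ (|C₁| * (1 + ‖ξ‖) ^ n) * ‖fiberFourier Φ (S z) ξ‖ * (1 + ‖ξ‖) ^ (k + 1) := by
          gcongr
          exact h1.trans (by gcongr; exact le_abs_self _)
      _ = |C₁| * ((1 + ‖ξ‖) ^ (n + (k + 1)) * ‖fiberFourier Φ (S z) ξ‖) := by
          rw [pow_add]; ring
      _ ≤ D := by rw [hD]; gcongr
  have hΨi : Integrable Ψ ((volume.prod ν).prod volume) := by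
    have h1 : Integrable (K.indicator fun _ => D) ((volume : Measure (Euc d)).prod ν) :=
      (integrable_indicator_iff hK.measurableSet).2 (integrableOn_const hK.measure_lt_top.ne)
    refine (h1.mul_prod hqi).mono' hΨc.aestronglyMeasurable (Eventually.of_forall ?_)
    rintro ⟨z, ξ⟩
    by_cases hz : z ∈ K
    · simpa [hz] using hbd z hz ξ
    · simp [hz, hΨ, hzero z hz ξ]
  -- Joint integrability would give integrability of the slices only for almost every `x`; the same
  -- majorant gives it for every `x`.
  have hΨx : ∀ x, Integrable (fun w : H × Euc k => Ψ ((x, w.1), w.2)) (ν.prod volume) := fun x => by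
    have hK2 : IsCompact (Prod.snd '' K) := hK.image continuous_snd
    have h1 : Integrable ((Prod.snd '' K).indicator fun _ => D) ν :=
      (integrable_indicator_iff hK2.measurableSet).2 (integrableOn_const hK2.measure_lt_top.ne)
    refine (h1.mul_prod hqi).mono' (hΨc.comp (by fun_prop)).aestronglyMeasurable
      (Eventually.of_forall ?_)
    rintro ⟨h, ξ⟩
    by_cases hz : (x, h) ∈ K
    · have : h ∈ Prod.snd '' K := ⟨_, hz, rfl⟩
      simpa [this] using hbd _ hz ξ
    · have h0 : Ψ ((x, h), ξ) = 0 := by simp [hΨ, hzero _ hz ξ]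
      simp only [h0, norm_zero]
      have hq0 : 0 ≤ q ξ := by positivity
      exact mul_nonneg (indicator_nonneg (fun _ _ => by positivity) _) hq0
  rw [symbolPairing_eq, symbolPairing_eq]
  congr 1
  have hR : ∫ x' : Euc d', ∫ ξ, a (S.symm x').1 ξ * fiberFourier Φ x' ξ =
      ∫ z, (∫ ξ, Ψ (z, ξ)) ∂(volume.prod ν) := by
    rw [← hS.integral_comp S.toHomeomorph.measurableEmbedding]
    simp [hΨ]
  rw [hR, integral_prod _ hΨi.integral_prod_left]
  congr 1
  ext x
  rw [integral_integral_swap (f := fun h ξ => Ψ ((x, h), ξ)) (hΨx x)]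
  congr 1
  ext ξ
  rw [fiberFourier_partialIntegral ν S hΦ.continuous hc, ← integral_const_mul]

end Fubini

/-! ## Classical symbols -/

section Symbols

/-- With no term subtracted and no derivative taken, the asymptotic expansion says `a = O(‖ξ‖ ^ Re
m)` for `‖ξ‖ ≥ 1`. The unit ball is handled by compactness, and `Re m` is rounded up to a natural
number. -/
theorem IsClassicalSymbol.exists_norm_le {d k : ℕ} {m : ℂ} {a : Euc d → Euc k → ℂ}
    {A : ℕ → Euc d → Euc k → ℂ} (h : IsClassicalSymbol m a A) (K : Set (Euc d))
    (hK : IsCompact K) : ∃ (n : ℕ) (C : ℝ), ∀ x ∈ K, ∀ ξ, ‖a x ξ‖ ≤ C * (1 + ‖ξ‖) ^ n := by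
  obtain ⟨C₁, h1⟩ := h.asymptotic 0 0 0 K hK
  obtain ⟨C₂, h2⟩ := (hK.prod (isCompact_closedBall (0 : Euc k) 1)).exists_bound_of_continuousOn
    h.smooth.continuous.continuousOn
  obtain ⟨n, hn⟩ := exists_nat_ge m.re
  refine ⟨n, |C₁| + |C₂|, fun x hx ξ => ?_⟩
  have hp : 1 ≤ (1 + ‖ξ‖) ^ n := one_le_pow₀ (by linarith [norm_nonneg ξ])
  rcases le_total 1 ‖ξ‖ with hξ | hξ
  · have h3 := h1 x hx ξ hξ
    simp only [Finset.range_zero, Finset.sum_empty, sub_zero, norm_iteratedFDeriv_zero,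
      Nat.cast_zero] at h3
    calc _ ≤ C₁ * ‖ξ‖ ^ m.re := h3
      _ ≤ |C₁| * ‖ξ‖ ^ (n : ℝ) := by
          gcongr
          · exact le_abs_self _
      _ = |C₁| * ‖ξ‖ ^ n := by rw [Real.rpow_natCast]
      _ ≤ (|C₁| + |C₂|) * (1 + ‖ξ‖) ^ n := by
          gcongr
          · linarith [abs_nonneg C₂]
          · linarith
  · have h3 := h2 (x, ξ) ⟨hx, by simpa using hξ⟩
    calc _ ≤ |C₂| := h3.trans (le_abs_self _)
      _ ≤ |C₁| + |C₂| := by linarith [abs_nonneg C₁]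
      _ ≤ _ := le_mul_of_one_le_right (by positivity) hp

/-- Joint smoothness of the derivatives in the second variable alone. It makes the mixed derivatives
of a symbol remainder accessible to the chain rule in `x`; the pointwise hypothesis on `Ω` leaves
room for the singularity of the homogeneous terms at `ξ = 0`. -/
theorem contDiffAt_iteratedFDeriv_snd {X Y E : Type*} [NormedAddCommGroup X] [NormedSpace ℝ X]
    [NormedAddCommGroup Y] [NormedSpace ℝ Y] [NormedAddCommGroup E] [NormedSpace ℝ E]
    {r : X → Y → E} {Ω : Set (X × Y)} (hr : ∀ z ∈ Ω, ContDiffAt ℝ ∞ (Function.uncurry r) z)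
    (l : ℕ) : ∀ z ∈ Ω, ContDiffAt ℝ ∞ (fun z : X × Y => iteratedFDeriv ℝ l (r z.1) z.2) z := by
  induction l with
  | zero =>
    intro z hz
    have h := ((continuousMultilinearCurryFin0 ℝ Y E).symm.contDiff (n := ∞)).contDiffAt.comp z
      (hr z hz)
    exact h
  | succ l ih =>
    intro z hz
    have h1 : ContDiffAt ℝ ∞ (fun w : X × Y => fderiv ℝ (iteratedFDeriv ℝ l (r w.1)) w.2) z := by
      refine ContDiffAt.fderiv (n := ∞) (f := fun w : X × Y => iteratedFDeriv ℝ l (r w.1))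
        (g := Prod.snd) ?_ contDiffAt_snd (by simp)
      exact (ih z hz).comp (f := fun q : (X × Y) × Y => (q.1.1, q.2)) (z, z.2)
        (by fun_prop)
    have h2 := ((continuousMultilinearCurryLeftEquiv ℝ (fun _ : Fin (l + 1) => Y) E).symm.contDiff
      (n := ∞)).contDiffAt.comp z h1
    refine h2.congr_of_eventuallyEq (Eventually.of_forall fun w => ?_)
    simp [iteratedFDeriv_succ_eq_comp_left]

theorem norm_iteratedFDeriv_comp_clm_le {X Y E : Type*} [NormedAddCommGroup X] [NormedSpace ℝ X]
    [NormedAddCommGroup Y] [NormedSpace ℝ Y] [NormedAddCommGroup E] [NormedSpace ℝ E]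
    {g : Y → E} (hg : ContDiff ℝ ∞ g) (π : X →L[ℝ] Y) (i : ℕ) (x : X) :
    ‖iteratedFDeriv ℝ i (fun x => g (π x)) x‖ ≤ ‖iteratedFDeriv ℝ i g (π x)‖ * ‖π‖ ^ i := by
  have h := π.iteratedFDeriv_comp_right hg x (i := i) (by exact_mod_cast le_top)
  change ‖iteratedFDeriv ℝ i (g ∘ π) x‖ ≤ _
  rw [h]
  simpa using ContinuousMultilinearMap.norm_compContinuousLinearMap_le
    (iteratedFDeriv ℝ i g (π x)) fun _ : Fin i => π

/-- Only the `x`-derivatives feel the linear map: `i` of them cost a factor `‖π‖ ^ i`. Everything in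
`ξ`, including the orders, is untouched. -/
theorem IsClassicalSymbol.comp_clm {d d' k : ℕ} {m : ℂ} {a : Euc d → Euc k → ℂ}
    {A : ℕ → Euc d → Euc k → ℂ} (h : IsClassicalSymbol m a A) (π : Euc d' →L[ℝ] Euc d) :
    IsClassicalSymbol m (fun x' => a (π x')) (fun j x' => A j (π x')) where
  smooth := h.smooth.comp
    (by fun_prop : ContDiff ℝ ∞ fun z : Euc d' × Euc k => (π z.1, z.2))
  smooth_term j := (h.smooth_term j).comp
    (by fun_prop : ContDiff ℝ ∞ fun z : Euc d' × Euc k => (π z.1, z.2)).contDiffOn fun _ hz => hz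
  homogeneous j x ξ t hξ ht := h.homogeneous j (π x) ξ t hξ ht
  asymptotic N i l K hK := by
    obtain ⟨C, hC⟩ := h.asymptotic N i l (π '' K) (hK.image π.continuous)
    refine ⟨C * ‖π‖ ^ i, fun x hx ξ hξ => ?_⟩
    have hξ0 : ξ ≠ 0 := fun h0 => by simp [h0] at hξ; linarith
    set g : Euc d → ContinuousMultilinearMap ℝ (fun _ : Fin l => Euc k) ℂ := fun y =>
      iteratedFDeriv ℝ l (fun ξ' => a y ξ' - ∑ j ∈ Finset.range N, A j y ξ') ξ with hg
    have hgs : ContDiff ℝ ∞ g := by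
      rw [contDiff_iff_contDiffAt]
      intro y
      have h1 := contDiffAt_iteratedFDeriv_snd (Ω := {z : Euc d × Euc k | z.2 ≠ 0})
        (r := fun y ξ' => a y ξ' - ∑ j ∈ Finset.range N, A j y ξ') (fun z hz => by
          have ho : IsOpen {z : Euc d × Euc k | z.2 ≠ 0} :=
            isOpen_ne_fun continuous_snd continuous_const
          exact h.smooth.contDiffAt.sub (ContDiffAt.sum fun j _ =>
            (h.smooth_term j).contDiffAt (ho.mem_nhds hz))) l (y, ξ) hξ0
      exact h1.comp y (by fun_prop : ContDiffAt ℝ ∞ (fun y : Euc d => (y, ξ)) y)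
    calc _ ≤ ‖iteratedFDeriv ℝ i g (π x)‖ * ‖π‖ ^ i := norm_iteratedFDeriv_comp_clm_le hgs π i x
      _ ≤ C * ‖ξ‖ ^ (m.re - (N : ℝ) - (l : ℝ)) * ‖π‖ ^ i := by
          gcongr
          exact hC (π x) ⟨x, hx, rfl⟩ ξ hξ
      _ = _ := by ring

end Symbols

/-! ## Smooth charts -/

section Charts

variable {n : ℕ} {M : Type*} [TopologicalSpace M] [ChartedSpace (Euc n) M]
  {F F₁ : Type*} [NormedAddCommGroup F] [NormedSpace ℝ F]
  [NormedAddCommGroup F₁] [NormedSpace ℝ F₁]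

theorem isSmoothChart_of_mem_maximalAtlas {e : OpenPartialHomeomorph M (Euc n)}
    (he : e ∈ IsManifold.maximalAtlas (𝓡 n) ∞ M) : IsSmoothChart n e :=
  ⟨contMDiffOn_of_mem_maximalAtlas he, contMDiffOn_symm_of_mem_maximalAtlas he⟩

theorem isSmoothChart_chartAt [IsManifold (𝓡 n) ∞ M] (x : M) :
    IsSmoothChart n (chartAt (Euc n) x) :=
  isSmoothChart_of_mem_maximalAtlas (IsManifold.chart_mem_maximalAtlas x)

namespace IsSmoothChart

variable {e : OpenPartialHomeomorph M F} {e₁ : OpenPartialHomeomorph M F₁}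

theorem restrOpen (he : IsSmoothChart n e) {s : Set M} (hs : IsOpen s) :
    IsSmoothChart n (e.restrOpen s hs) :=
  ⟨he.contMDiffOn.mono inter_subset_left, he.contMDiffOn_symm.mono inter_subset_left⟩

theorem trans (he : IsSmoothChart n e) {ψ : OpenPartialHomeomorph F F₁}
    (h : ContDiffOn ℝ ∞ ψ ψ.source) (h' : ContDiffOn ℝ ∞ ψ.symm ψ.target) :
    IsSmoothChart n (e.trans ψ) where
  contMDiffOn := (contMDiffOn_iff_contDiffOn.2 h).comp
    (he.contMDiffOn.mono inter_subset_left) fun y hy => hy.2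
  contMDiffOn_symm := by
    refine he.contMDiffOn_symm.comp ((contMDiffOn_iff_contDiffOn.2 h').mono inter_subset_left) ?_
    intro z hz
    exact hz.2

/-- The change of charts is smooth. -/
theorem contDiffOn_comp_symm (he : IsSmoothChart n e) (he₁ : IsSmoothChart n e₁) :
    ContDiffOn ℝ ∞ (fun z => e₁ (e.symm z)) (e.target ∩ e.symm ⁻¹' e₁.source) :=
  contMDiffOn_iff_contDiffOn.1
    (he₁.contMDiffOn.comp (he.contMDiffOn_symm.mono inter_subset_left) fun _ hz => hz.2)

theorem comp_contDiffOn (he : IsSmoothChart n e) {f : M → ℂ} {s : Set M}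
    (hf : ContMDiffOn (𝓡 n) 𝓘(ℝ, ℂ) ∞ f s) :
    ContDiffOn ℝ ∞ (fun z => f (e.symm z)) (e.target ∩ e.symm ⁻¹' s) :=
  contMDiffOn_iff_contDiffOn.1
    (hf.comp (he.contMDiffOn_symm.mono inter_subset_left) fun _ hz => hz.2)

end IsSmoothChart

/-- A smooth function on an open set that vanishes off a compact subset extends by zero. -/
theorem contDiff_indicator {E : Type*} [NormedAddCommGroup E] [NormedSpace ℝ E] {Ω K : Set F}
    (hΩ : IsOpen Ω) (hK : IsCompact K) (hKΩ : K ⊆ Ω) {φ : F → E} (hφ : ContDiffOn ℝ ∞ φ Ω)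
    (h0 : ∀ z ∈ Ω, z ∉ K → φ z = 0) :
    ContDiff ℝ ∞ (Ω.indicator φ) ∧ tsupport (Ω.indicator φ) ⊆ K := by
  have hs : tsupport (Ω.indicator φ) ⊆ K := by
    refine closure_minimal (fun z hz => ?_) hK.isClosed
    by_contra hzK
    refine hz ?_
    by_cases hzΩ : z ∈ Ω
    · rw [indicator_of_mem hzΩ, h0 z hzΩ hzK]
    · exact indicator_of_notMem hzΩ _
  refine ⟨contDiff_iff_contDiffAt.2 fun z => ?_, hs⟩
  by_cases hz : z ∈ Ω
  · refine (hφ.contDiffAt (hΩ.mem_nhds hz)).congr_of_eventuallyEq ?_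
    filter_upwards [hΩ.mem_nhds hz] with y hy using indicator_of_mem hy _
  · refine (contDiffAt_const (c := (0 : E))).congr_of_eventuallyEq ?_
    filter_upwards [hK.isClosed.isOpen_compl.mem_nhds fun h => hz (hKΩ h)] with y hy
    by_contra h
    exact hy (hs (subset_tsupport _ h))

/-- A smooth function with compact support in the target of a chart defines a test function. -/
theorem exists_testFunction_of_chart [T2Space M] {e : OpenPartialHomeomorph M F}
    (he : IsSmoothChart n e) {φ : F → ℂ} (hφ : ContDiffOn ℝ ∞ φ e.target) {K : Set F}
    (hK : IsCompact K) (hKe : K ⊆ e.target) (h0 : ∀ z ∈ e.target, z ∉ K → φ z = 0) :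
    ∃ g : testFunctions n M, tsupport (g : M → ℂ) ⊆ e.symm '' K ∧
      ∀ y, (g : M → ℂ) y = e.source.indicator (fun y => φ (e y)) y := by
  set g : M → ℂ := e.source.indicator fun y => φ (e y) with hg
  have hK' : IsCompact (e.symm '' K) :=
    hK.image_of_continuousOn (e.continuousOn_symm.mono hKe)
  have hs : tsupport g ⊆ e.symm '' K := by
    refine closure_minimal (fun y hy => ?_) hK'.isClosed
    have hye : y ∈ e.source := by
      by_contra h
      exact hy (indicator_of_notMem h _)
    have hyK : e y ∈ K := by
      by_contra h
      refine hy ?_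
      rw [hg, indicator_of_mem hye, h0 _ (e.map_source hye) h]
    exact ⟨e y, hyK, e.left_inv hye⟩
  refine ⟨⟨g, ?_, hK'.of_isClosed_subset (isClosed_tsupport _) hs⟩, hs, fun y => rfl⟩
  intro y
  by_cases hy : y ∈ e.source
  · have h1 : ContMDiffAt (𝓡 n) 𝓘(ℝ, ℂ) ∞ (fun y => φ (e y)) y :=
      (((contMDiffOn_iff_contDiffOn.2 hφ).comp he.contMDiffOn e.mapsTo).contMDiffAt
        (e.open_source.mem_nhds hy))
    refine h1.congr_of_eventuallyEq ?_
    filter_upwards [e.open_source.mem_nhds hy] with z hz using indicator_of_mem hz _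
  · refine (contMDiffAt_const (c := (0 : ℂ))).congr_of_eventuallyEq ?_
    have hyK : y ∈ (e.symm '' K)ᶜ := fun ⟨z, hz, hzy⟩ => hy (hzy ▸ e.map_target (hKe hz))
    filter_upwards [hK'.isClosed.isOpen_compl.mem_nhds hyK] with z hz
    by_contra h
    exact hz (hs (subset_tsupport _ h))

end Charts

/-! ## Smooth densities in charts -/

/-- Charts take values in products, whose `volume` is by definition the product measure. -/
instance volume_prod_isAddHaar {E F : Type*} [NormedAddCommGroup E] [NormedSpace ℝ E]
    [MeasureSpace E] [BorelSpace E] [SecondCountableTopology E]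
    [NormedAddCommGroup F] [NormedSpace ℝ F] [MeasureSpace F] [BorelSpace F]
    [SecondCountableTopology F]
    [(volume : Measure E).IsAddHaarMeasure] [(volume : Measure F).IsAddHaarMeasure]
    [SFinite (volume : Measure E)] [SFinite (volume : Measure F)] :
    (volume : Measure (E × F)).IsAddHaarMeasure :=
  inferInstanceAs ((volume : Measure E).prod (volume : Measure F)).IsAddHaarMeasure

section Density

variable {n : ℕ} {M : Type*} [TopologicalSpace M] [MeasurableSpace M] [BorelSpace M]
  {F : Type*} [NormedAddCommGroup F] [NormedSpace ℝ F] [MeasureSpace F] [BorelSpace F]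
  {μ : Measure M} {e : OpenPartialHomeomorph M F} {w : F → ℝ}

omit [NormedSpace ℝ F] in
theorem aemeasurable_chart : AEMeasurable e (μ.restrict e.source) :=
  e.continuousOn.aemeasurable e.open_source.measurableSet

namespace HasDensityInChart

theorem measure_preimage (h : HasDensityInChart μ e w) {S : Set F} (hS : MeasurableSet S) :
    μ (e ⁻¹' S ∩ e.source) = ∫⁻ z in S ∩ e.target, ENNReal.ofReal (w z) := by
  have h1 := congrArg (fun m => m S) h.map_eq
  rw [Measure.map_apply_of_aemeasurable aemeasurable_chart hS,
    Measure.restrict_apply' e.open_source.measurableSet, withDensity_apply _ hS,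
    Measure.restrict_restrict hS] at h1
  exact h1

omit [BorelSpace M] in
theorem aemeasurable_ofReal (h : HasDensityInChart μ e w) :
    AEMeasurable (fun z => ENNReal.ofReal (w z)) (volume.restrict e.target) :=
  (h.contDiffOn.continuousOn.aemeasurable e.open_target.measurableSet).ennreal_ofReal

theorem restrOpen (h : HasDensityInChart μ e w) {s : Set M} (hs : IsOpen s) :
    HasDensityInChart μ (e.restrOpen s hs) w where
  contDiffOn := h.contDiffOn.mono inter_subset_left
  pos z hz := h.pos z hz.1
  map_eq := by
    ext S hS
    have ht : (e.restrOpen s hs).target = e.target ∩ e.symm ⁻¹' s := rfl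
    rw [Measure.map_apply_of_aemeasurable aemeasurable_chart hS,
      Measure.restrict_apply' (e.restrOpen s hs).open_source.measurableSet,
      withDensity_apply _ hS, Measure.restrict_restrict hS]
    have h1 := h.measure_preimage
      (hS.inter (e.restrOpen s hs).open_target.measurableSet)
    have h2 : e ⁻¹' (S ∩ (e.restrOpen s hs).target) ∩ e.source =
        e.restrOpen s hs ⁻¹' S ∩ (e.restrOpen s hs).source := by
      rw [ht, OpenPartialHomeomorph.restrOpen_source]
      ext y
      constructor
      · rintro ⟨⟨hy1, hy2, hy3⟩, hy4⟩
        refine ⟨hy1, hy4, ?_⟩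
        rw [mem_preimage, e.left_inv hy4] at hy3
        exact hy3
      · rintro ⟨hy1, hy2, hy3⟩
        refine ⟨⟨hy1, e.map_source hy2, ?_⟩, hy2⟩
        rw [mem_preimage, e.left_inv hy2]
        exact hy3
    rw [h2] at h1
    rw [h1, inter_assoc]
    congr 2
    rw [ht]
    congr 1
    exact inter_eq_left.2 inter_subset_left

/-- Integration in a chart. -/
theorem integral_eq [SecondCountableTopology F] (h : HasDensityInChart μ e w) {φ : M → ℂ}
    (hφ : ContinuousOn φ e.source) (h0 : ∀ y ∉ e.source, φ y = 0) :
    ∫ y, φ y ∂μ = ∫ z in e.target, (w z : ℂ) * φ (e.symm z) := by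
  have h1 : ∫ y, φ y ∂μ = ∫ y in e.source, φ (e.symm (e y)) ∂μ := by
    rw [← setIntegral_eq_integral_of_forall_compl_eq_zero h0]
    refine setIntegral_congr_fun e.open_source.measurableSet fun y hy => ?_
    simp only [e.left_inv hy]
  have hc : AEStronglyMeasurable (fun z => φ (e.symm z)) (volume.restrict e.target) :=
    (hφ.comp e.continuousOn_symm e.mapsTo_symm).aestronglyMeasurable e.open_target.measurableSet
  have hc' : AEStronglyMeasurable (fun z => φ (e.symm z))
      (Measure.map e (μ.restrict e.source)) := by
    rw [h.map_eq]
    exact hc.mono_ac (withDensity_absolutelyContinuous _ _)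
  rw [h1, ← integral_map aemeasurable_chart hc', h.map_eq,
    integral_withDensity_eq_integral_toReal_smul₀ h.aemeasurable_ofReal
      (Eventually.of_forall fun _ => ENNReal.ofReal_lt_top)]
  refine setIntegral_congr_fun e.open_target.measurableSet fun z hz => ?_
  simp only [ENNReal.toReal_ofReal (h.pos z hz).le, Complex.real_smul]

theorem exists_nhds_measure_lt_top [LocallyCompactSpace F]
    [IsFiniteMeasureOnCompacts (volume : Measure F)]
    (h : HasDensityInChart μ e w) {x : M} (hx : x ∈ e.source) : ∃ s ∈ 𝓝 x, μ s < ⊤ := by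
  obtain ⟨B, hB, hxB, hBt⟩ := exists_compact_subset e.open_target (e.map_source hx)
  refine ⟨e ⁻¹' B ∩ e.source, ?_, ?_⟩
  · exact inter_mem ((e.continuousAt hx).preimage_mem_nhds (mem_interior_iff_mem_nhds.1 hxB))
      (e.open_source.mem_nhds hx)
  · rw [h.measure_preimage hB.measurableSet, inter_eq_left.2 hBt]
    obtain ⟨C, hC⟩ := hB.exists_bound_of_continuousOn (h.contDiffOn.continuousOn.mono hBt)
    calc ∫⁻ z in B, ENNReal.ofReal (w z) ≤ ∫⁻ _ in B, ENNReal.ofReal C :=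
          setLIntegral_mono measurable_const fun z hz =>
            ENNReal.ofReal_le_ofReal ((le_abs_self _).trans (hC z hz))
      _ < ⊤ := by
          rw [setLIntegral_const]
          exact ENNReal.mul_lt_top ENNReal.ofReal_lt_top hB.measure_lt_top

theorem measure_ne_zero [(volume : Measure F).IsOpenPosMeasure]
    (h : HasDensityInChart μ e w) {x : M} (hx : x ∈ e.source) {U : Set M} (hU : IsOpen U)
    (hxU : x ∈ U) : μ U ≠ 0 := by
  intro h0
  set S := e.target ∩ e.symm ⁻¹' U with hSdef
  have hS : IsOpen S := e.isOpen_inter_preimage_symm hU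
  have h1 := h.measure_preimage hS.measurableSet
  rw [inter_eq_left.2 inter_subset_left] at h1
  have h2 : μ (e ⁻¹' S ∩ e.source) = 0 := by
    refine measure_mono_null (fun y hy => ?_) h0
    have := hy.1.2
    rwa [mem_preimage, e.left_inv hy.2] at this
  rw [h2, eq_comm, lintegral_eq_zero_iff' (h.aemeasurable_ofReal.mono_measure
    (Measure.restrict_mono inter_subset_left le_rfl))] at h1
  have h3 : volume S = 0 := by
    rw [Filter.EventuallyEq, ae_restrict_iff' hS.measurableSet] at h1
    refine measure_mono_null ?_ h1
    intro z hz
    have := h.pos z hz.1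
    simp [hz, this]
  have h4 : S.Nonempty := ⟨e x, e.map_source hx, by rwa [mem_preimage, e.left_inv hx]⟩
  exact (hS.measure_pos volume h4).ne' h3

end HasDensityInChart

theorem IsSmoothDensity.isLocallyFiniteMeasure [ChartedSpace (Euc n) M]
    (hμ : IsSmoothDensity n μ) : IsLocallyFiniteMeasure μ where
  finiteAtNhds x := by
    obtain ⟨w, hw⟩ := hμ x
    obtain ⟨s, hs, hs'⟩ := hw.exists_nhds_measure_lt_top (mem_chart_source _ x)
    exact ⟨s, hs, hs'⟩

theorem IsSmoothDensity.isOpenPosMeasure [ChartedSpace (Euc n) M]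
    (hμ : IsSmoothDensity n μ) : μ.IsOpenPosMeasure where
  open_pos U hU hne := by
    obtain ⟨x, hx⟩ := hne
    obtain ⟨w, hw⟩ := hμ x
    exact hw.measure_ne_zero (mem_chart_source _ x) hU hx

/-- By the Leibniz formula the determinant is a polynomial in the matrix entries, which depend
linearly on `A`. -/
theorem contDiff_det {F : Type*} [NormedAddCommGroup F] [NormedSpace ℝ F] [FiniteDimensional ℝ F] :
    ContDiff ℝ ∞ fun A : F →L[ℝ] F => A.det := by
  classical
  set b := Module.finBasis ℝ F
  have h : (fun A : F →L[ℝ] F => A.det) = fun A : F →L[ℝ] F => ∑ σ : Equiv.Perm (Fin _),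
      ((Equiv.Perm.sign σ : ℤ) : ℝ) * ∏ i, b.coord (σ i) (A (b i)) := by
    ext A
    have h1 : A.det = LinearMap.det (A : F →ₗ[ℝ] F) := rfl
    rw [h1, ← LinearMap.det_toMatrix b, Matrix.det_apply']
    simp [LinearMap.toMatrix_apply]
  rw [h]
  refine ContDiff.sum fun σ _ => contDiff_const.mul (contDiff_prod fun i _ => ?_)
  have h2 : ContDiff ℝ ∞ fun x => b.coord (σ i) x :=
    (LinearMap.toContinuousLinearMap (b.coord (σ i))).contDiff
  exact h2.comp (ContinuousLinearMap.apply ℝ F (b i)).contDiff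

/-- A smooth positive density is smooth and positive in every chart. -/
theorem IsSmoothDensity.exists_hasDensityInChart [ChartedSpace (Euc n) M]
    [IsManifold (𝓡 n) ∞ M] [FiniteDimensional ℝ F] [(volume : Measure F).IsAddHaarMeasure]
    (hμ : IsSmoothDensity n μ) (he : IsSmoothChart n e) (x : M)
    (hsub : e.source ⊆ (chartAt (Euc n) x).source) (L : F ≃L[ℝ] Euc n) :
    ∃ w, HasDensityInChart μ e w := by
  obtain ⟨w₀, hw₀⟩ := hμ x
  set c := chartAt (Euc n) x with hc
  have hcs : IsSmoothChart n c := isSmoothChart_chartAt x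
  have hmaps : ∀ z ∈ e.target, e.symm z ∈ c.source := fun z hz => hsub (e.map_target hz)
  -- The change of charts is brought back to `F` by `L`, since the change of variables formula with
  -- a determinant needs a map from a space to itself.
  set T : F → F := fun z => L.symm (c (e.symm z)) with hT
  have hTs : ContDiffOn ℝ ∞ T e.target :=
    L.symm.contDiff.comp_contDiffOn
      ((he.contDiffOn_comp_symm hcs).mono fun z hz => ⟨hz, hmaps z hz⟩)
  have hTd : ∀ z ∈ e.target, HasFDerivAt T (fderiv ℝ T z) z := fun z hz =>
    ((hTs.contDiffAt (e.open_target.mem_nhds hz)).differentiableAt (by simp)).hasFDerivAt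
  have hinj : InjOn T e.target := fun z hz z' hz' h => by
    have h1 := c.injOn (hmaps z hz) (hmaps z' hz') (L.symm.injective h)
    exact e.symm.injOn hz hz' h1
  -- The opposite change of charts is a smooth local inverse of `T`, so the product of the two
  -- determinants is `1`.
  have hdet : ∀ z ∈ e.target, (fderiv ℝ T z).det ≠ 0 := fun z hz => by
    set R : F → F := fun y => e (c.symm (L y)) with hR
    have hRd : DifferentiableAt ℝ R (T z) := by
      have h1 : ContDiffOn ℝ ∞ (fun y => e (c.symm y)) (c.target ∩ c.symm ⁻¹' e.source) :=
        hcs.contDiffOn_comp_symm he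
      have h2 : L (T z) ∈ c.target ∩ c.symm ⁻¹' e.source := by
        simp only [hT, L.apply_symm_apply]
        refine ⟨c.map_source (hmaps z hz), ?_⟩
        rw [mem_preimage, c.left_inv (hmaps z hz)]
        exact e.map_target hz
      have h3 := (h1.contDiffAt ((c.isOpen_inter_preimage_symm e.open_source).mem_nhds
        h2)).differentiableAt (by simp)
      exact h3.comp (T z) L.differentiableAt
    have h1 : HasFDerivAt (R ∘ T) ((fderiv ℝ R (T z)).comp (fderiv ℝ T z)) z :=
      hRd.hasFDerivAt.comp z (hTd z hz)
    have h2 : R ∘ T =ᶠ[𝓝 z] id := by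
      filter_upwards [e.open_target.mem_nhds hz] with y hy
      simp [hR, hT, c.left_inv (hmaps y hy), e.right_inv hy]
    have h3 := h1.unique ((hasFDerivAt_id z).congr_of_eventuallyEq h2)
    have h4 : LinearMap.det (fderiv ℝ R (T z) : F →ₗ[ℝ] F) *
        LinearMap.det (fderiv ℝ T z : F →ₗ[ℝ] F) = 1 := by
      rw [← LinearMap.det_comp, ← ContinuousLinearMap.toLinearMap_comp, h3]
      simp
    exact right_ne_zero_of_mul (h4.trans_ne one_ne_zero)
  have : (Measure.map L (volume : Measure F)).IsAddHaarMeasure :=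
    L.isAddHaarMeasure_map volume
  -- `L` is an arbitrary linear isomorphism and need not preserve volume; `β` is the constant by
  -- which the Haar measures differ.
  set β : NNReal := (volume : Measure (Euc n)).addHaarScalarFactor (Measure.map L volume) with hβ
  have hβ0 : 0 < β := Measure.addHaarScalarFactor_pos_of_isAddHaarMeasure _ _
  have hvol : (volume : Measure (Euc n)) = β • Measure.map L (volume : Measure F) :=
    Measure.isAddLeftInvariant_eq_smul _ _
  have hw₀T : ContDiffOn ℝ ∞ (fun z => w₀ (L (T z))) e.target := by
    simp only [hT, L.apply_symm_apply]
    exact hw₀.contDiffOn.comp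
      ((he.contDiffOn_comp_symm hcs).mono fun z hz => ⟨hz, hmaps z hz⟩)
      fun z hz => c.map_source (hmaps z hz)
  refine ⟨fun z => β * (|(fderiv ℝ T z).det| * w₀ (L (T z))), ?_, ?_, ?_⟩
  · refine contDiffOn_const.mul (ContDiffOn.mul (fun z hz => ?_) hw₀T)
    have h1 : ContDiffAt ℝ ∞ (fun z => (fderiv ℝ T z).det) z :=
      contDiff_det.contDiffAt.comp z ((hTs.fderiv_of_isOpen (m := ∞) e.open_target
        (by simp)).contDiffAt (e.open_target.mem_nhds hz))
    exact ((contDiffAt_abs (n := ⊤) (hdet z hz)).comp z h1).contDiffWithinAt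
  · intro z hz
    have h1 : 0 < w₀ (L (T z)) := by
      simp only [hT, L.apply_symm_apply]
      exact hw₀.pos _ (c.map_source (hmaps z hz))
    have h2 := abs_pos.2 (hdet z hz)
    have h3 : (0 : ℝ) < β := hβ0
    positivity
  · ext S hS
    rw [Measure.map_apply_of_aemeasurable aemeasurable_chart hS,
      Measure.restrict_apply' e.open_source.measurableSet, withDensity_apply _ hS,
      Measure.restrict_restrict hS]
    set Q : Set F := S ∩ e.target with hQ
    have hQm : MeasurableSet Q := hS.inter e.open_target.measurableSet
    have hTQ : MeasurableSet (T '' Q) := hQm.image_of_continuousOn_injOn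
      (hTs.continuousOn.mono inter_subset_right) (hinj.mono inter_subset_right)
    have himg : e ⁻¹' S ∩ e.source = c ⁻¹' (L '' (T '' Q)) ∩ c.source := by
      ext y
      constructor
      · rintro ⟨hy1, hy2⟩
        refine ⟨⟨T (e y), ⟨e y, ⟨hy1, e.map_source hy2⟩, rfl⟩, ?_⟩, hsub hy2⟩
        simp [hT, e.left_inv hy2]
      · rintro ⟨⟨_, ⟨z, hz, rfl⟩, hzy⟩, hy2⟩
        simp only [hT, L.apply_symm_apply] at hzy
        have h1 := c.injOn (hmaps z hz.2) hy2 hzy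
        subst h1
        refine ⟨?_, e.map_target hz.2⟩
        rw [mem_preimage, e.right_inv hz.2]
        exact hz.1
    have hsubt : L '' (T '' Q) ⊆ c.target := by
      rintro _ ⟨_, ⟨z, hz, rfl⟩, rfl⟩
      simp only [hT, L.apply_symm_apply]
      exact c.map_source (hmaps z hz.2)
    have hLm : MeasurableEmbedding L := L.toHomeomorph.measurableEmbedding
    rw [himg, hw₀.measure_preimage (hLm.measurableSet_image.2 hTQ), inter_eq_left.2 hsubt, hvol,
      Measure.restrict_smul, lintegral_smul_measure, hLm.restrict_map, hLm.lintegral_map,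
      preimage_image_eq _ L.injective,
      lintegral_image_eq_lintegral_abs_det_fderiv_mul volume hQm
        (fun z hz => (hTd z hz.2).hasFDerivWithinAt) (hinj.mono inter_subset_right)]
    have h5 : ∀ z, ENNReal.ofReal (β * (|(fderiv ℝ T z).det| * w₀ (L (T z)))) =
        (β : ENNReal) * (ENNReal.ofReal |(fderiv ℝ T z).det| *
          ENNReal.ofReal (w₀ (L (T z)))) := fun z => by
      rw [ENNReal.ofReal_mul (NNReal.coe_nonneg β), ENNReal.ofReal_mul (abs_nonneg _),
        ENNReal.ofReal_coe_nnreal]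
    simp only [h5]
    rw [lintegral_const_mul' _ _ ENNReal.coe_ne_top]
    rfl

end Density

/-! ## Charts adapted to a submersion -/

section Submersion

variable {n n' : ℕ} {M M' : Type*}
  [TopologicalSpace M] [ChartedSpace (Euc n) M] [IsManifold (𝓡 n) ∞ M]
  [TopologicalSpace M'] [ChartedSpace (Euc n') M'] [IsManifold (𝓡 n') ∞ M']
  {F : Type*} [NormedAddCommGroup F] [NormedSpace ℝ F]

omit [IsManifold (𝓡 n) ∞ M] [IsManifold (𝓡 n') ∞ M'] in
/-- Every chart of the base of a submersion lifts to a chart of the total space in which the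
submersion is a projection. -/
theorem exists_chart_lift {p : M' → M} (hp : Manifold.IsSubmersion (𝓡 n') (𝓡 n) ∞ p)
    {e : OpenPartialHomeomorph M F} (he : IsSmoothChart n e) {x : M'} (hx : p x ∈ e.source)
    {O : Set M'} (hO : IsOpen O) (hxO : x ∈ O) :
    ∃ (r : ℕ) (e' : OpenPartialHomeomorph M' (F × Euc r)), n + r = n' ∧ IsSmoothChart n' e' ∧
      x ∈ e'.source ∧ e'.source ⊆ O ∧
      ∀ y ∈ e'.source, p y ∈ e.source ∧ (e' y).1 = e (p y) := by
  obtain ⟨C, _, _, hC⟩ := hp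
  have h := hC x
  set φ := h.domChart with hφ
  set ψ := h.codChart with hψ
  -- The complement `C` in the local normal form is an abstract normed space. It is
  -- finite-dimensional because `Euc n × C` is isomorphic to `Euc n'`, so it can be replaced by `Euc
  -- r`.
  have : FiniteDimensional ℝ (Euc n × C) :=
    LinearEquiv.finiteDimensional h.equiv.toLinearEquiv
  have : FiniteDimensional ℝ C :=
    FiniteDimensional.of_injective (LinearMap.inr ℝ (Euc n) C) LinearMap.inr_injective
  set r := Module.finrank ℝ C with hr
  have hdim : n + r = n' := by
    have := h.equiv.toLinearEquiv.finrank_eq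
    rw [Module.finrank_prod] at this
    simpa using this.symm
  have hCr : Module.finrank ℝ C = Module.finrank ℝ (Euc r) := by simp [hr]
  set Q : Euc n' ≃L[ℝ] (Euc n × Euc r) := h.equiv.trans
    ((ContinuousLinearEquiv.refl ℝ (Euc n)).prodCongr (ContinuousLinearEquiv.ofFinrankEq hCr))
    with hQ
  have hφs : IsSmoothChart n' φ := isSmoothChart_of_mem_maximalAtlas h.domChart_mem_maximalAtlas
  have hψs : IsSmoothChart n ψ := isSmoothChart_of_mem_maximalAtlas h.codChart_mem_maximalAtlas
  have hloc : ∀ y ∈ φ.source, p y ∈ ψ.source ∧ (Q (φ y)).1 = ψ (p y) := fun y hy => by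
    refine ⟨h.source_subset_preimage_source hy, ?_⟩
    have hy' : φ y ∈ (h.domChart.extend (𝓡 n')).target := by
      rw [OpenPartialHomeomorph.extend_target]
      exact ⟨φ.map_source hy, by simp⟩
    have h1 := h.writtenInCharts hy'
    simp only [Function.comp_apply, OpenPartialHomeomorph.extend_coe,
      OpenPartialHomeomorph.extend_coe_symm, modelWithCornersSelf_coe,
      modelWithCornersSelf_coe_symm, id] at h1
    rw [← hφ, ← hψ, φ.left_inv hy] at h1
    rw [h1]
    rfl
  -- In the normal form the first coordinate is `ψ ∘ p`. Applying the change of charts `τ` from `ψ`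
  -- to `e` on that factor turns it into `e ∘ p`.
  set τ : OpenPartialHomeomorph (Euc n) F := ψ.symm.trans e with hτ
  have hτ1 : ContDiffOn ℝ ∞ τ τ.source := hψs.contDiffOn_comp_symm he
  have hτ2 : ContDiffOn ℝ ∞ τ.symm τ.target := he.contDiffOn_comp_symm hψs
  set Qh : OpenPartialHomeomorph (Euc n') (Euc n × Euc r) :=
    Q.toHomeomorph.toOpenPartialHomeomorph with hQh
  set e₀ : OpenPartialHomeomorph M' (F × Euc r) :=
    (φ.trans Qh).trans (τ.prod (OpenPartialHomeomorph.refl (Euc r))) with he₀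
  have hs1 : IsSmoothChart n' (φ.trans Qh) :=
    hφs.trans Q.contDiff.contDiffOn Q.symm.contDiff.contDiffOn
  have hs2 : IsSmoothChart n' e₀ :=
    hs1.trans (hτ1.prodMap contDiffOn_id) (hτ2.prodMap contDiffOn_id)
  refine ⟨r, e₀.restrOpen O hO, hdim, hs2.restrOpen hO, ⟨⟨⟨h.mem_domChart_source, trivial⟩, ?_⟩,
    hxO⟩, fun y hy => hy.2, ?_⟩
  · have h1 := hloc x h.mem_domChart_source
    refine ⟨⟨?_, ?_⟩, trivial⟩
    · change (Q (φ x)).1 ∈ ψ.target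
      rw [h1.2]
      exact ψ.map_source h1.1
    · change ψ.symm (Q (φ x)).1 ∈ e.source
      rw [h1.2, ψ.left_inv h1.1]
      exact hx
  · rintro y ⟨⟨⟨hy1, -⟩, ⟨hy2, hy3⟩, -⟩, -⟩
    have h1 := hloc y hy1
    have h2 : ψ.symm (Q (φ y)).1 = p y := by rw [h1.2, ψ.left_inv h1.1]
    refine ⟨?_, ?_⟩
    · change ψ.symm (Q (φ y)).1 ∈ e.source at hy3
      rwa [h2] at hy3
    · change e (ψ.symm (Q (φ y)).1) = e (p y)
      rw [h2]

end Submersion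

/-! ## Integration along the fibres, in charts -/

section LocalSubmersion

variable {n n' : ℕ} {M M' : Type*}
  [TopologicalSpace M] [ChartedSpace (Euc n) M] [MeasurableSpace M]
  [TopologicalSpace M'] [ChartedSpace (Euc n') M'] [MeasurableSpace M']
  {F F' H : Type} [NormedAddCommGroup F] [NormedSpace ℝ F] [MeasureSpace F]
  [NormedAddCommGroup F'] [NormedSpace ℝ F'] [MeasureSpace F']
  [NormedAddCommGroup H] [NormedSpace ℝ H] [MeasurableSpace H]

/-- Charts `e` and `e'` of the base and of the total space, with densities `w` and `w'`, in which
the map `p` is the projection of a product (up to the linear isomorphism `L`). -/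
structure LocalSubmersion (μ : Measure M) (μ' : Measure M') (p : M' → M)
    (e : OpenPartialHomeomorph M F) (e' : OpenPartialHomeomorph M' F')
    (L : F' ≃L[ℝ] (F × H)) (ν : Measure H) (w : F → ℝ) (w' : F' → ℝ) : Prop where
  continuous : Continuous p
  smooth : IsSmoothChart n e
  smooth' : IsSmoothChart n' e'
  density : HasDensityInChart μ e w
  density' : HasDensityInChart μ' e' w'
  measurePreserving : MeasurePreserving L volume (volume.prod ν)
  mapsTo : ∀ y ∈ e'.source, p y ∈ e.source
  fst_eq : ∀ y ∈ e'.source, (L (e' y)).1 = e (p y)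

/-- The function `f w` read in the chart `e` and extended by zero. -/
def chartDensity (e : OpenPartialHomeomorph M F) (w : F → ℝ) (f : M → ℂ) : F → ℂ :=
  e.target.indicator fun z => f (e.symm z) * (w z : ℂ)

theorem chartDensity_spec {μ : Measure M} {e : OpenPartialHomeomorph M F} {w : F → ℝ}
    (he : IsSmoothChart n e) (hw : HasDensityInChart μ e w) (f : testFunctions n M)
    (hf : tsupport (f : M → ℂ) ⊆ e.source) :
    ContDiff ℝ ∞ (chartDensity e w f) ∧
      tsupport (chartDensity e w f) ⊆ e '' tsupport (f : M → ℂ) := by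
  refine contDiff_indicator e.open_target
    (f.2.2.isCompact.image_of_continuousOn (e.continuousOn.mono hf)) ?_ ?_ ?_
  · rintro _ ⟨y, hy, rfl⟩
    exact e.map_source (hf hy)
  · refine ContDiffOn.mul ?_ (Complex.ofRealCLM.contDiff.comp_contDiffOn hw.contDiffOn)
    have h := he.comp_contDiffOn (s := univ) (contMDiffOn_univ.2 f.2.1)
    simpa using h
  · intro z hz hzK
    have : (f : M → ℂ) (e.symm z) = 0 := by
      by_contra h
      exact hzK ⟨e.symm z, subset_tsupport _ h, e.right_inv hz⟩
    rw [this, zero_mul]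

theorem hasCompactSupport_chartDensity {μ : Measure M} {e : OpenPartialHomeomorph M F} {w : F → ℝ}
    (he : IsSmoothChart n e) (hw : HasDensityInChart μ e w) (f : testFunctions n M)
    (hf : tsupport (f : M → ℂ) ⊆ e.source) : HasCompactSupport (chartDensity e w f) :=
  (f.2.2.isCompact.image_of_continuousOn (e.continuousOn.mono hf)).of_isClosed_subset
    (isClosed_tsupport _) (chartDensity_spec he hw f hf).2

namespace LocalSubmersion

variable {μ : Measure M} {μ' : Measure M'} {p : M' → M}
  {e : OpenPartialHomeomorph M F} {e' : OpenPartialHomeomorph M' F'}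
  {L : F' ≃L[ℝ] (F × H)} {ν : Measure H} {w : F → ℝ} {w' : F' → ℝ}

/-- Only fibres that meet the support of `f` contribute, so the partial integral is supported in the
compact set `e(p(supp f))`. -/
theorem mem_of_chartDensity_ne_zero (h : LocalSubmersion (n := n) (n' := n') μ μ' p e e' L ν w w')
    {f : M' → ℂ} {y : F} {z : H}
    (h0 : chartDensity e' w' f (L.symm (y, z)) ≠ 0) :
    y ∈ e.target ∧ y ∈ e '' (p '' tsupport f) := by
  have h1 : L.symm (y, z) ∈ e'.target := by
    by_contra hn
    exact h0 (indicator_of_notMem hn _)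
  rw [chartDensity, indicator_of_mem h1] at h0
  have h2 := left_ne_zero_of_mul h0
  have h3 := h.fst_eq _ (e'.map_target h1)
  rw [e'.right_inv h1, L.apply_symm_apply] at h3
  simp only at h3
  refine ⟨?_, ?_⟩
  · rw [h3]
    exact e.map_source (h.mapsTo _ (e'.map_target h1))
  · exact ⟨_, ⟨_, subset_tsupport _ h2, rfl⟩, h3.symm⟩

theorem partialIntegral_eq_zero
    (h : LocalSubmersion (n := n) (n' := n') μ μ' p e e' L ν w w')
    {f : M' → ℂ} {y : F} (hy : y ∉ e '' (p '' tsupport f)) :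
    ∫ z, chartDensity e' w' f (L.symm (y, z)) ∂ν = 0 := by
  have : ∀ z, chartDensity e' w' f (L.symm (y, z)) = 0 := fun z => by
    by_contra h0
    exact hy (h.mem_of_chartDensity_ne_zero h0).2
  simp [this]

variable [T2Space M] [BorelSpace M] [BorelSpace M'] [FiniteDimensional ℝ F] [BorelSpace F]
  [FiniteDimensional ℝ F'] [BorelSpace F'] [FiniteDimensional ℝ H] [BorelSpace H]
  [IsFiniteMeasureOnCompacts ν] [SFinite ν] [(volume : Measure F).IsAddHaarMeasure]

/-- In the charts of a local submersion, integration along the fibres is partial integration. -/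
theorem exists_fiberIntegral
    (h : LocalSubmersion (n := n) (n' := n') μ μ' p e e' L ν w w') (f : testFunctions n' M')
    (hf : tsupport (f : M' → ℂ) ⊆ e'.source) :
    ∃ g : testFunctions n M, tsupport (g : M → ℂ) ⊆ p '' tsupport (f : M' → ℂ) ∧
      tsupport (g : M → ℂ) ⊆ e.source ∧
      (∀ y, (g : M → ℂ) y = e.source.indicator (fun y => ((w (e y))⁻¹ : ℂ) *
        ∫ z, chartDensity e' w' f (L.symm (e y, z)) ∂ν) y) ∧
      (chartDensity e w g = fun y => ∫ z, chartDensity e' w' f (L.symm (y, z)) ∂ν) ∧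
      ∀ u : M → ℂ, ContinuousOn u e.source →
        ∫ x, u (p x) * (f : M' → ℂ) x ∂μ' = ∫ y, u y * (g : M → ℂ) y ∂μ := by
  set Φ : F' → ℂ := chartDensity e' w' f with hΦ
  obtain ⟨hΦs, hΦt⟩ := chartDensity_spec h.smooth' h.density' f hf
  have hΦc : HasCompactSupport Φ := hasCompactSupport_chartDensity h.smooth' h.density' f hf
  have hLs : ContDiff ℝ ∞ fun q : F × H => Φ (L.symm q) := hΦs.comp L.symm.contDiff
  have hLc : HasCompactSupport fun q : F × H => Φ (L.symm q) :=
    hΦc.comp_homeomorph L.symm.toHomeomorph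
  set I : F → ℂ := fun y => ∫ z, Φ (L.symm (y, z)) ∂ν with hI
  have hIs : ContDiff ℝ ∞ I := contDiff_partialIntegral ν hLs hLc
  have hpf : p '' tsupport (f : M' → ℂ) ⊆ e.source := by
    rintro _ ⟨x, hx, rfl⟩
    exact h.mapsTo x (hf hx)
  have hpfc : IsCompact (p '' tsupport (f : M' → ℂ)) := f.2.2.isCompact.image h.continuous
  have hI0 : ∀ y ∉ e '' (p '' tsupport (f : M' → ℂ)), I y = 0 := fun y hy =>
    h.partialIntegral_eq_zero hy
  have hK : e '' (p '' tsupport (f : M' → ℂ)) ⊆ e.target := by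
    rintro _ ⟨y, hy, rfl⟩
    exact e.map_source (hpf hy)
  have hw0 : ∀ z ∈ e.target, (w z : ℂ) ≠ 0 := fun z hz => by
    exact_mod_cast (h.density.pos z hz).ne'
  -- The direct image of `f μ'` has Lebesgue density `I` in the chart; dividing by `w` expresses it
  -- relative to `μ`.
  have hφ : ContDiffOn ℝ ∞ (fun z => ((w z)⁻¹ : ℂ) * I z) e.target := by
    refine ContDiffOn.mul ?_ hIs.contDiffOn
    exact ContDiffOn.inv (Complex.ofRealCLM.contDiff.comp_contDiffOn h.density.contDiffOn) hw0
  obtain ⟨g, hgs, hg⟩ := exists_testFunction_of_chart h.smooth hφ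
    (hpfc.image_of_continuousOn (e.continuousOn.mono hpf)) hK
    (fun z _ hzK => by rw [hI0 z hzK, mul_zero])
  have himg : e.symm '' (e '' (p '' tsupport (f : M' → ℂ))) = p '' tsupport (f : M' → ℂ) := by
    exact e.toPartialEquiv.symm_image_image_of_subset_source hpf
  rw [himg] at hgs
  have hgz : ∀ z ∈ e.target, (g : M → ℂ) (e.symm z) = ((w z)⁻¹ : ℂ) * I z := fun z hz => by
    rw [hg, indicator_of_mem (e.map_target hz), e.right_inv hz]
  refine ⟨g, hgs, hgs.trans hpf, hg, ?_, ?_⟩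
  · ext z
    by_cases hz : z ∈ e.target
    · rw [chartDensity, indicator_of_mem hz, hgz z hz]
      have := hw0 z hz
      field_simp
    · rw [chartDensity, indicator_of_notMem hz]
      exact (hI0 z fun hzK => hz (hK hzK)).symm
  -- Continuity of `u` on `e.source` is all that is used, so the identity applies both to test
  -- functions and to smooth remainders defined only near the chart.
  · intro u hu
    have hfc : Continuous (f : M' → ℂ) := f.2.1.continuous
    have hgc : Continuous (g : M → ℂ) := g.2.1.continuous
    have h1 : ∫ x, u (p x) * (f : M' → ℂ) x ∂μ' = ∫ z, u (e.symm (L z).1) * Φ z := by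
      rw [h.density'.integral_eq (φ := fun x => u (p x) * (f : M' → ℂ) x)
        ((hu.comp h.continuous.continuousOn h.mapsTo).mul hfc.continuousOn)
        (fun x hx => by rw [image_eq_zero_of_notMem_tsupport fun hx' => hx (hf hx'), mul_zero]),
        ← integral_indicator e'.open_target.measurableSet]
      congr 1
      ext z
      by_cases hz : z ∈ e'.target
      · rw [indicator_of_mem hz, hΦ, chartDensity, indicator_of_mem hz]
        have h3 := h.fst_eq _ (e'.map_target hz)
        rw [e'.right_inv hz] at h3
        rw [h3, e.left_inv (h.mapsTo _ (e'.map_target hz))]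
        ring
      · rw [indicator_of_notMem hz, hΦ, chartDensity, indicator_of_notMem hz, mul_zero]
    have h2 : ∫ z, u (e.symm (L z).1) * Φ z =
        ∫ q, u (e.symm q.1) * Φ (L.symm q) ∂(volume.prod ν) := by
      rw [← h.measurePreserving.integral_comp L.toHomeomorph.measurableEmbedding]
      simp
    have hint : Integrable (fun q : F × H => u (e.symm q.1) * Φ (L.symm q))
        ((volume : Measure F).prod ν) := by
      set K : Set (F × H) := tsupport fun q : F × H => Φ (L.symm q) with hKdef
      have hKc : IsCompact K := hLc.isCompact
      have hKt : ∀ q ∈ K, q.1 ∈ e.target := by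
        intro q hq
        have hq' : L.symm q ∈ tsupport Φ := by
          have : K ⊆ L.symm ⁻¹' tsupport Φ := closure_minimal
            (fun q hq => subset_tsupport _ hq) ((isClosed_tsupport _).preimage L.symm.continuous)
          exact this hq
        obtain ⟨x, hx, hxq⟩ := hΦt hq'
        have h3 := h.fst_eq x (hf hx)
        rw [hxq, L.apply_symm_apply] at h3
        rw [h3]
        exact e.map_source (h.mapsTo x (hf hx))
      rw [← integrableOn_iff_integrable_of_support_subset (s := K) fun q hq =>
        subset_tsupport _ (right_ne_zero_of_mul hq)]
      refine ContinuousOn.integrableOn_compact hKc ?_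
      refine ContinuousOn.mul ?_ hLs.continuous.continuousOn
      exact (hu.comp e.continuousOn_symm e.mapsTo_symm).comp continuousOn_fst hKt
    have h4 : ∫ q, u (e.symm q.1) * Φ (L.symm q) ∂(volume.prod ν) =
        ∫ y, u (e.symm y) * I y := by
      rw [integral_prod _ hint]
      simp only [integral_const_mul, hI]
    have h5 : ∫ y, u y * (g : M → ℂ) y ∂μ = ∫ z, u (e.symm z) * I z := by
      rw [h.density.integral_eq (φ := fun y => u y * (g : M → ℂ) y) (hu.mul hgc.continuousOn)
        (fun y hy => by
          rw [image_eq_zero_of_notMem_tsupport fun hy' => hy (hpf (hgs hy')), mul_zero]),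
        ← setIntegral_eq_integral_of_forall_compl_eq_zero (s := e.target)
          (f := fun z => u (e.symm z) * I z)
          (fun z hz => by rw [hI0 z fun hzK => hz (hK hzK), mul_zero])]
      refine setIntegral_congr_fun e.open_target.measurableSet fun z hz => ?_
      simp only [hgz z hz]
      have := hw0 z hz
      field_simp
    rw [h1, h2, h4, h5]

end LocalSubmersion

end LocalSubmersion

/-! ## Continuity of the integration along the fibres -/

section Continuity

variable {n n' : ℕ} {M M' : Type*}
  [TopologicalSpace M] [ChartedSpace (Euc n) M] [IsManifold (𝓡 n) ∞ M] [T2Space M]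
  [MeasurableSpace M] [BorelSpace M]
  [TopologicalSpace M'] [ChartedSpace (Euc n') M'] [IsManifold (𝓡 n') ∞ M'] [T2Space M']
  [MeasurableSpace M'] [BorelSpace M']

/-- The product of a test function with a smooth function. -/
def testMul (χ : M → ℂ) (hχ : ContMDiff (𝓡 n) 𝓘(ℝ, ℂ) ∞ χ) (f : testFunctions n M) :
    testFunctions n M :=
  ⟨fun y => χ y * (f : M → ℂ) y, contDiff_mul.comp_contMDiff (hχ.prodMk_space f.2.1), f.2.2.mul_left⟩

omit [IsManifold (𝓡 n) ∞ M] [T2Space M] [MeasurableSpace M] [BorelSpace M] in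
theorem tsupport_testMul_subset (χ : M → ℂ) (hχ : ContMDiff (𝓡 n) 𝓘(ℝ, ℂ) ∞ χ)
    (f : testFunctions n M) :
    tsupport (testMul χ hχ f : M → ℂ) ⊆ tsupport χ ∩ tsupport (f : M → ℂ) :=
  subset_inter (closure_mono fun _ hy => left_ne_zero_of_mul hy)
    (closure_mono fun _ hy => right_ne_zero_of_mul hy)

omit [T2Space M] [MeasurableSpace M] [BorelSpace M] in
-- The definition of convergence looks only at the preferred charts; the chain rule for changes of
-- charts, used locally, transfers it to an arbitrary smooth chart.
theorem TendstoZero.smoothCvg_chart {F : Type*} [NormedAddCommGroup F] [NormedSpace ℝ F]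
    [FiniteDimensional ℝ F] {f : ℕ → testFunctions n M} (hf : TendstoZero f)
    {e : OpenPartialHomeomorph M F} (he : IsSmoothChart n e) :
    SmoothCvg e.target fun i z => (f i : M → ℂ) (e.symm z) := by
  have h0 : ∀ x : M, SmoothCvg (chartAt (Euc n) x).target
      fun i z => (f i : M → ℂ) ((chartAt (Euc n) x).symm z) := fun x => by
    refine ⟨fun i => ?_, fun j C hC hCt => tendstoUniformlyOn_zero_iff.1 (hf.2 x j C hC hCt)⟩
    have h := (isSmoothChart_chartAt x).comp_contDiffOn (s := univ) (contMDiffOn_univ.2 (f i).2.1)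
    simpa using h
  refine SmoothCvg.of_locally fun z hz => ?_
  set c := chartAt (Euc n) (e.symm z) with hc
  have hO : IsOpen (e.target ∩ e.symm ⁻¹' c.source) := e.isOpen_inter_preimage_symm c.open_source
  refine ⟨_, hO, ⟨hz, mem_chart_source _ _⟩, ?_⟩
  refine ((h0 (e.symm z)).comp c.open_target hO
    (he.contDiffOn_comp_symm (isSmoothChart_chartAt (e.symm z)))
    fun y hy => c.map_source hy.2).congr hO fun i y hy => ?_
  simp only
  rw [c.left_inv hy.2]

variable {F F' H : Type} [NormedAddCommGroup F] [NormedSpace ℝ F] [MeasureSpace F]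
  [NormedAddCommGroup F'] [NormedSpace ℝ F'] [MeasureSpace F']
  [NormedAddCommGroup H] [NormedSpace ℝ H] [MeasurableSpace H]
  [FiniteDimensional ℝ F] [FiniteDimensional ℝ F'] [FiniteDimensional ℝ H] [BorelSpace H]

omit [T2Space M'] [BorelSpace M'] in
omit [BorelSpace M] [FiniteDimensional ℝ F] in
-- The fixed cut-off `χ` keeps all supports in one compact subset of the chart domain. Convergence
-- then passes through multiplication by `χ w'`, partial integration, change of charts and
-- multiplication by `w⁻¹`.
theorem TendstoZero.fiberIntegral {μ : Measure M} {μ' : Measure M'} {p : M' → M}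
    {e : OpenPartialHomeomorph M F} {e' : OpenPartialHomeomorph M' F'}
    {L : F' ≃L[ℝ] (F × H)} {ν : Measure H} [IsFiniteMeasureOnCompacts ν] {w : F → ℝ}
    {w' : F' → ℝ}
    (h : LocalSubmersion (n := n) (n' := n') μ μ' p e e' L ν w w')
    {f : ℕ → testFunctions n' M'} (hf : TendstoZero f) {χ : M' → ℂ}
    (hχ : ContMDiff (𝓡 n') 𝓘(ℝ, ℂ) ∞ χ) (hχe : tsupport χ ⊆ e'.source)
    {g : ℕ → testFunctions n M}
    (hgs : ∀ i, tsupport (g i : M → ℂ) ⊆ p '' tsupport (testMul χ hχ (f i) : M' → ℂ))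
    (hg : ∀ i y, (g i : M → ℂ) y = e.source.indicator (fun y => ((w (e y))⁻¹ : ℂ) *
        ∫ z, chartDensity e' w' (testMul χ hχ (f i)) (L.symm (e y, z)) ∂ν) y) :
    TendstoZero g := by
  obtain ⟨⟨K₀, hK₀, hfK₀⟩, -⟩ := id hf
  set K : Set M' := K₀ ∩ tsupport χ with hKdef
  have hK : IsCompact K := hK₀.inter_right (isClosed_tsupport _)
  have hKe : K ⊆ e'.source := fun x hx => hχe hx.2
  have hfK : ∀ i, tsupport (testMul χ hχ (f i) : M' → ℂ) ⊆ K := fun i x hx =>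
    ⟨hfK₀ i (tsupport_testMul_subset χ hχ (f i) hx).2, (tsupport_testMul_subset χ hχ (f i) hx).1⟩
  have hpK : IsCompact (p '' K) := hK.image h.continuous
  have hgK : ∀ i, tsupport (g i : M → ℂ) ⊆ p '' K := fun i => (hgs i).trans (image_mono (hfK i))
  have heK : IsCompact (e' '' K) := hK.image_of_continuousOn (e'.continuousOn.mono hKe)
  have hts : ∀ i, tsupport (chartDensity e' w' (testMul χ hχ (f i))) ⊆ e' '' K := fun i =>
    (chartDensity_spec h.smooth' h.density' _ ((hfK i).trans hKe)).2.trans (image_mono (hfK i))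
  have h1 : SmoothCvg univ fun i => chartDensity e' w' (testMul χ hχ (f i)) := by
    refine SmoothCvg.of_locally fun z _ => ?_
    by_cases hz : z ∈ e'.target
    · refine ⟨_, e'.open_target, hz, ?_⟩
      have hχw : ContDiffOn ℝ ∞ (fun z => χ (e'.symm z) * (w' z : ℂ)) e'.target := by
        refine ContDiffOn.mul ?_
          (Complex.ofRealCLM.contDiff.comp_contDiffOn h.density'.contDiffOn)
        simpa using h.smooth'.comp_contDiffOn (s := univ) (contMDiffOn_univ.2 hχ)
      refine ((hf.smoothCvg_chart h.smooth').mul e'.open_target hχw).congr e'.open_target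
        fun i y hy => ?_
      rw [chartDensity, indicator_of_mem hy]
      change χ (e'.symm y) * (f i : M' → ℂ) (e'.symm y) * (w' y : ℂ) = _
      ring
    · have hO : IsOpen (e' '' K)ᶜ := heK.isClosed.isOpen_compl
      refine ⟨_, hO, fun ⟨x, hx, hxz⟩ => hz (hxz ▸ e'.map_source (hKe hx)), ?_⟩
      exact SmoothCvg.zero.congr hO fun i y hy =>
        image_eq_zero_of_notMem_tsupport fun hy' => hy (hts i hy')
  have h2 : SmoothCvg univ fun i (q : F × H) =>
      chartDensity e' w' (testMul χ hχ (f i)) (L.symm q) :=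
    h1.comp isOpen_univ isOpen_univ L.symm.contDiff.contDiffOn (mapsTo_univ _ _)
  have h3 : SmoothCvg univ fun i (y : F) =>
      ∫ z, chartDensity e' w' (testMul χ hχ (f i)) (L.symm (y, z)) ∂ν := by
    refine h2.partialIntegral ν (heK.image L.continuous) fun i => ?_
    refine closure_minimal (fun q hq => ?_) (heK.image L.continuous).isClosed
    exact ⟨L.symm q, hts i (subset_tsupport _ hq), L.apply_symm_apply q⟩
  refine ⟨⟨p '' K, hpK, hgK⟩, fun x j C hC hCt => ?_⟩
  set c := chartAt (Euc n) x with hc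
  have hcs : IsSmoothChart n c := isSmoothChart_chartAt x
  have h4 : SmoothCvg c.target fun i z => (g i : M → ℂ) (c.symm z) := by
    refine SmoothCvg.of_locally fun z hz => ?_
    by_cases hze : c.symm z ∈ e.source
    · have hO : IsOpen (c.target ∩ c.symm ⁻¹' e.source) :=
        c.isOpen_inter_preimage_symm e.open_source
      refine ⟨_, hO, ⟨hz, hze⟩, ?_⟩
      have hψ : ContDiffOn ℝ ∞ (fun z => e (c.symm z)) (c.target ∩ c.symm ⁻¹' e.source) :=
        hcs.contDiffOn_comp_symm h.smooth
      have hw : ContDiffOn ℝ ∞ (fun z => ((w (e (c.symm z)))⁻¹ : ℂ))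
          (c.target ∩ c.symm ⁻¹' e.source) := by
        have hw1 : ContDiffOn ℝ ∞ (fun z => (w (e (c.symm z)) : ℂ))
            (c.target ∩ c.symm ⁻¹' e.source) :=
          Complex.ofRealCLM.contDiff.comp_contDiffOn
            (h.density.contDiffOn.comp hψ fun y hy => e.map_source hy.2)
        refine hw1.inv fun y hy => ?_
        exact_mod_cast (h.density.pos _ (e.map_source hy.2)).ne'
      refine ((h3.comp isOpen_univ hO hψ (mapsTo_univ _ _)).mul hO hw).congr hO fun i y hy => ?_
      simp only
      rw [hg, indicator_of_mem (s := e.source) hy.2]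
    · have hO : IsOpen (c.target ∩ c.symm ⁻¹' (p '' K)ᶜ) :=
        c.isOpen_inter_preimage_symm hpK.isClosed.isOpen_compl
      refine ⟨_, hO, ⟨hz, fun ⟨x, hx, hxz⟩ => hze (hxz ▸ h.mapsTo x (hKe hx))⟩, ?_⟩
      exact SmoothCvg.zero.congr hO fun i y hy =>
        image_eq_zero_of_notMem_tsupport fun hy' => hy.2 (hgK i hy')
  exact tendstoUniformlyOn_zero_iff.2 (h4.eventually_le j C hC hCt)

end Continuity

/-! ## Integration along the fibres of a submersion and pull-back of distributions -/

section FiberIntegral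

variable {n n' : ℕ} {M M' : Type*}
  [TopologicalSpace M] [ChartedSpace (Euc n) M] [MeasurableSpace M] [BorelSpace M]
  [TopologicalSpace M'] [ChartedSpace (Euc n') M'] [MeasurableSpace M'] [BorelSpace M']
  {μ : Measure M} {μ' : Measure M'} {p : M' → M}

/-- The complex conjugate of a test function. -/
def testConj (f : testFunctions n M) : testFunctions n M :=
  ⟨fun y => star ((f : M → ℂ) y), Complex.conjCLE.contDiff.comp_contMDiff f.2.1,
    f.2.2.comp_left (g := star) (star_zero ℂ)⟩

theorem integrable_mul_testFunction [IsFiniteMeasureOnCompacts μ] {h : M → ℂ} (hh : Continuous h)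
    (f : testFunctions n M) : Integrable (fun y => h y * (f : M → ℂ) y) μ :=
  (hh.mul f.2.1.continuous).integrable_of_hasCompactSupport f.2.2.mul_left

/-- Testing against the conjugate of `δ = g₁ - g₂` gives `∫ |δ|² dμ = 0`. As `δ` is continuous and
`μ` charges nonempty open sets, `δ = 0`. -/
theorem testFunction_eq_of_integral_eq [IsFiniteMeasureOnCompacts μ] [μ.IsOpenPosMeasure]
    {g₁ g₂ : testFunctions n M}
    (h : ∀ u : testFunctions n M, ∫ y, (u : M → ℂ) y * (g₁ : M → ℂ) y ∂μ =
      ∫ y, (u : M → ℂ) y * (g₂ : M → ℂ) y ∂μ) : g₁ = g₂ := by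
  set δ : testFunctions n M := g₁ - g₂ with hδ
  have h1 := h (testConj δ)
  have hc : Continuous (testConj δ : M → ℂ) := (testConj δ).2.1.continuous
  rw [← sub_eq_zero, ← integral_sub (integrable_mul_testFunction hc g₁)
    (integrable_mul_testFunction hc g₂)] at h1
  have h2 : ∀ y, (testConj δ : M → ℂ) y * (g₁ : M → ℂ) y - (testConj δ : M → ℂ) y *
      (g₂ : M → ℂ) y = ((Complex.normSq ((δ : M → ℂ) y) : ℝ) : ℂ) := fun y => by
    rw [← mul_sub, Complex.normSq_eq_conj_mul_self]
    rfl
  simp only [h2] at h1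
  rw [integral_complex_ofReal, Complex.ofReal_eq_zero] at h1
  rw [← sub_eq_zero, ← hδ]
  by_contra hne
  have : ∃ x, (δ : M → ℂ) x ≠ 0 := by
    by_contra! hx
    exact hne (Subtype.ext (funext hx))
  obtain ⟨x, hx⟩ := this
  have h3 : 0 < ∫ y, Complex.normSq ((δ : M → ℂ) y) ∂μ :=
    Continuous.integral_pos_of_hasCompactSupport_nonneg_nonzero (x := x)
      (Complex.continuous_normSq.comp δ.2.1.continuous)
      (δ.2.2.comp_left (g := Complex.normSq) (map_zero _))
      (fun y => Complex.normSq_nonneg _) (by simpa using hx)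
  exact h3.ne' h1

omit [BorelSpace M'] in
theorem IsFiberIntegral.unique [IsFiniteMeasureOnCompacts μ] [μ.IsOpenPosMeasure]
    {f : testFunctions n' M'} {g₁ g₂ : testFunctions n M} (h₁ : IsFiberIntegral μ μ' p f g₁)
    (h₂ : IsFiberIntegral μ μ' p f g₂) : g₁ = g₂ :=
  testFunction_eq_of_integral_eq fun u => (h₁ u).symm.trans (h₂ u)

theorem IsFiberIntegral.add [IsFiniteMeasureOnCompacts μ] [IsFiniteMeasureOnCompacts μ']
    (hp : Continuous p) {f₁ f₂ : testFunctions n' M'} {g₁ g₂ : testFunctions n M}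
    (h₁ : IsFiberIntegral μ μ' p f₁ g₁) (h₂ : IsFiberIntegral μ μ' p f₂ g₂) :
    IsFiberIntegral μ μ' p (f₁ + f₂) (g₁ + g₂) := fun u => by
  have hu : Continuous (u : M → ℂ) := u.2.1.continuous
  have e1 := integral_add (integrable_mul_testFunction (μ := μ') (hu.comp hp) f₁)
    (integrable_mul_testFunction (hu.comp hp) f₂)
  have e2 := integral_add (integrable_mul_testFunction (μ := μ) hu g₁)
    (integrable_mul_testFunction hu g₂)
  simp only [Submodule.coe_add, Pi.add_apply, mul_add]
  simp only [Function.comp_apply] at e1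
  rw [e1, e2, h₁ u, h₂ u]

omit [BorelSpace M] [BorelSpace M'] in
theorem IsFiberIntegral.smul {f : testFunctions n' M'} {g : testFunctions n M}
    (h : IsFiberIntegral μ μ' p f g) (c : ℂ) : IsFiberIntegral μ μ' p (c • f) (c • g) := fun u => by
  have e1 : ∀ a b : ℂ, a * (c * b) = c * (a * b) := fun a b => by ring
  simp only [Submodule.coe_smul, Pi.smul_apply, smul_eq_mul, e1, integral_const_mul]
  rw [h u]

theorem IsFiberIntegral.sum [IsFiniteMeasureOnCompacts μ] [IsFiniteMeasureOnCompacts μ']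
    (hp : Continuous p) {ι : Type*} (t : Finset ι) {f : ι → testFunctions n' M'}
    {g : ι → testFunctions n M} (h : ∀ i ∈ t, IsFiberIntegral μ μ' p (f i) (g i)) :
    IsFiberIntegral μ μ' p (∑ i ∈ t, f i) (∑ i ∈ t, g i) := by
  classical
  induction t using Finset.induction_on with
  | empty => intro u; simp
  | insert i t hi ih =>
    rw [Finset.sum_insert hi, Finset.sum_insert hi]
    exact (h i (Finset.mem_insert_self _ _)).add hp
      (ih fun j hj => h j (Finset.mem_insert_of_mem hj))

omit [BorelSpace M'] in
-- The definition of the pull-back supplies some fibre integral. By uniqueness it may be replaced by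
-- whichever one is at hand, in particular by the explicit one in charts.
theorem IsPullback.apply_eq {P : Distr n M} {P' : Distr n' M'} (hμ : IsSmoothDensity n μ)
    (h : IsPullback μ μ' p P P') {f : testFunctions n' M'} {g : testFunctions n M}
    (hg : IsFiberIntegral μ μ' p f g) : P'.toLin f = P.toLin g := by
  have := hμ.isLocallyFiniteMeasure
  have := hμ.isOpenPosMeasure
  obtain ⟨g', hg', hP⟩ := h f
  rw [hP, hg'.unique hg]

omit [MeasurableSpace M] [BorelSpace M] in
theorem isClosed_support (P : Distr n M) : IsClosed P.support := by
  rw [← isOpen_compl_iff, isOpen_iff_mem_nhds]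
  intro x hx
  simp only [Distr.support, mem_compl_iff, mem_ofPred_eq, not_forall, not_exists, not_and,
    not_not] at hx
  obtain ⟨U, hU, hUP⟩ := hx
  filter_upwards [eventually_mem_nhds_iff.2 hU] with y hy
  intro hyP
  obtain ⟨f, hf, hf0⟩ := hyP U hy
  exact hf0 (hUP f hf)

end FiberIntegral

theorem coe_sum_testFunctions {n : ℕ} {M : Type*} [TopologicalSpace M] [ChartedSpace (Euc n) M]
    {ι : Type*} (t : Finset ι) (f : ι → testFunctions n M) (y : M) :
    ((∑ i ∈ t, f i : testFunctions n M) : M → ℂ) y = ∑ i ∈ t, (f i : M → ℂ) y := by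
  rw [Submodule.coe_sum, Finset.sum_apply]

theorem sum_testMul_eq {n : ℕ} {M : Type*} [TopologicalSpace M] [ChartedSpace (Euc n) M]
    {K : Set M} {t : Finset M} {χ : M → M → ℂ}
    (hχ : ∀ x, ContMDiff (𝓡 n) 𝓘(ℝ, ℂ) ∞ (χ x)) (h1 : ∀ y ∈ K, ∑ x ∈ t, χ x y = 1)
    (f : testFunctions n M) (hf : tsupport (f : M → ℂ) ⊆ K) :
    ∑ x ∈ t, testMul (χ x) (hχ x) f = f := by
  refine Subtype.ext (funext fun y => ?_)
  rw [coe_sum_testFunctions]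
  change ∑ x ∈ t, χ x y * (f : M → ℂ) y = _
  rw [← Finset.sum_mul]
  by_cases hy : y ∈ K
  · rw [h1 y hy, one_mul]
  · rw [image_eq_zero_of_notMem_tsupport fun hy' => hy (hf hy'), mul_zero]

/-- Finitely many smooth functions subordinate to an open cover whose sum is `1` on a compact
set. -/
theorem exists_finite_cutoffs {n : ℕ} {M : Type*} [TopologicalSpace M] [ChartedSpace (Euc n) M]
    [IsManifold (𝓡 n) ∞ M] [T2Space M] [SecondCountableTopology M] {K : Set M} (hK : IsCompact K)
    (W : M → Set M) (hW : ∀ x, IsOpen (W x)) (hxW : ∀ x, x ∈ W x) :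
    ∃ (t : Finset M) (χ : M → M → ℂ), (∀ x, ContMDiff (𝓡 n) 𝓘(ℝ, ℂ) ∞ (χ x)) ∧
      (∀ x, tsupport (χ x) ⊆ W x) ∧ ∀ y ∈ K, ∑ x ∈ t, χ x y = 1 := by
  have : LocallyCompactSpace M := ChartedSpace.locallyCompactSpace (Euc n) M
  obtain ⟨ρ, hρ⟩ := SmoothPartitionOfUnity.exists_isSubordinate (𝓡 n) hK.isClosed W hW
    fun x _ => mem_iUnion.2 ⟨x, hxW x⟩
  -- By local finiteness only finitely many members of the partition meet the compact set `K`.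
  have hfin := ρ.locallyFinite.finite_nonempty_inter_compact hK
  refine ⟨hfin.toFinset, fun x y => (ρ x y : ℂ), fun x =>
    Complex.ofRealCLM.contDiff.comp_contMDiff (ρ x).contMDiff, fun x => ?_, fun y hy => ?_⟩
  · refine (closure_mono fun y hy => ?_).trans (hρ x)
    exact fun h0 => hy (by simp [h0])
  · have h1 := ρ.sum_eq_one hy
    rw [finsum_eq_sum_of_support_subset (s := hfin.toFinset)] at h1
    · simp only
      exact_mod_cast h1
    · intro x hx
      simp only [Finite.coe_toFinset, mem_ofPred_eq]
      exact ⟨y, hx, hy⟩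

/-! ### Fibre integrals and pull-backs on whole manifolds. -/

section Global

variable {n n' : ℕ} {M M' : Type*}
  [TopologicalSpace M] [ChartedSpace (Euc n) M] [IsManifold (𝓡 n) ∞ M]
  [MeasurableSpace M] [BorelSpace M]
  [TopologicalSpace M'] [ChartedSpace (Euc n') M'] [IsManifold (𝓡 n') ∞ M']
  [MeasurableSpace M'] [BorelSpace M']
  {μ : Measure M} {μ' : Measure M'} {p : M' → M}

/-- The base chart is shrunk into `U`, where a smooth representative of the distribution may be
available; the lifted chart is kept inside a preferred chart, where the density of `μ'` is known. -/
theorem exists_localSubmersion (hμ : IsSmoothDensity n μ) (hμ' : IsSmoothDensity n' μ')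
    (hp : Manifold.IsSubmersion (𝓡 n') (𝓡 n) ∞ p) (x : M') {U : Set M} (hU : IsOpen U)
    (hxU : p x ∈ U) :
    ∃ (r : ℕ) (e : OpenPartialHomeomorph M (Euc n))
      (e' : OpenPartialHomeomorph M' (Euc n × Euc r)) (w : Euc n → ℝ) (w' : Euc n × Euc r → ℝ),
      LocalSubmersion (n := n) (n' := n') μ μ' p e e' (ContinuousLinearEquiv.refl ℝ _) volume w w' ∧
      x ∈ e'.source ∧ e.source ⊆ U := by
  obtain ⟨w, hw⟩ := hμ (p x)
  set e := (chartAt (Euc n) (p x)).restrOpen U hU with he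
  have hes : IsSmoothChart n e := (isSmoothChart_chartAt (p x)).restrOpen hU
  obtain ⟨r, e', hr, he's, hxe', hsub, hproj⟩ := exists_chart_lift hp hes (x := x)
    ⟨mem_chart_source _ _, hxU⟩ (chartAt (Euc n') x).open_source (mem_chart_source _ x)
  have hfr : Module.finrank ℝ (Euc n × Euc r) = Module.finrank ℝ (Euc n') := by
    simp [hr]
  obtain ⟨w', hw'⟩ := hμ'.exists_hasDensityInChart he's x hsub
    (ContinuousLinearEquiv.ofFinrankEq hfr)
  exact ⟨r, e, e', w, w', ⟨hp.contMDiff.continuous, hes, he's, hw.restrOpen hU, hw',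
    MeasurePreserving.id _, fun y hy => (hproj y hy).1, fun y hy => (hproj y hy).2⟩, hxe',
    fun y hy => hy.2⟩

variable [T2Space M] [T2Space M'] [SecondCountableTopology M']

theorem exists_isFiberIntegral (hμ : IsSmoothDensity n μ) (hμ' : IsSmoothDensity n' μ')
    (hp : Manifold.IsSubmersion (𝓡 n') (𝓡 n) ∞ p) (f : testFunctions n' M') :
    ∃ g : testFunctions n M, IsFiberIntegral μ μ' p f g ∧
      tsupport (g : M → ℂ) ⊆ p '' tsupport (f : M' → ℂ) := by
  have := hμ.isLocallyFiniteMeasure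
  have := hμ'.isLocallyFiniteMeasure
  choose r e e' w w' hloc hx _ using fun x =>
    exists_localSubmersion hμ hμ' hp x isOpen_univ (mem_univ (p x))
  obtain ⟨t, χ, hχ, hχs, hχ1⟩ := exists_finite_cutoffs (n := n') f.2.2.isCompact (fun x => (e' x).source)
    (fun x => (e' x).open_source) hx
  choose g hgs _ _ _ hg using fun x => (hloc x).exists_fiberIntegral (testMul (χ x) (hχ x) f)
    ((tsupport_testMul_subset _ _ _).trans (inter_subset_left.trans (hχs x)))
  refine ⟨∑ x ∈ t, g x, ?_, ?_⟩
  · have h1 := IsFiberIntegral.sum (μ := μ) (μ' := μ') hp.contMDiff.continuous t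
      (f := fun x => testMul (χ x) (hχ x) f) (g := g)
      fun x _ u => hg x u u.2.1.continuous.continuousOn
    rwa [sum_testMul_eq hχ hχ1 f le_rfl] at h1
  · have hc : IsCompact (p '' tsupport (f : M' → ℂ)) := f.2.2.isCompact.image hp.contMDiff.continuous
    refine closure_minimal (fun y hy => ?_) hc.isClosed
    rw [Function.mem_support, coe_sum_testFunctions] at hy
    obtain ⟨x, _, hx0⟩ := Finset.exists_ne_zero_of_sum_ne_zero hy
    exact image_mono ((tsupport_testMul_subset _ _ _).trans inter_subset_right)
      (hgs x (subset_tsupport _ hx0))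

/-- The pull-back of a distribution by a submersion is well defined. -/
theorem existsUnique_isPullback (hμ : IsSmoothDensity n μ) (hμ' : IsSmoothDensity n' μ')
    (hp : Manifold.IsSubmersion (𝓡 n') (𝓡 n) ∞ p) (P : Distr n M) :
    ∃! P' : Distr n' M', IsPullback μ μ' p P P' := by
  have := hμ.isLocallyFiniteMeasure
  have := hμ.isOpenPosMeasure
  have := hμ'.isLocallyFiniteMeasure
  have hpc := hp.contMDiff.continuous
  choose G hG _ using exists_isFiberIntegral hμ hμ' hp
  -- `G` merely chooses a fibre integral for each function; uniqueness forces the choice to be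
  -- linear.
  let T : testFunctions n' M' →ₗ[ℂ] testFunctions n M :=
    { toFun := G
      map_add' := fun f₁ f₂ => (hG _).unique ((hG f₁).add hpc (hG f₂))
      map_smul' := fun c f => (hG _).unique ((hG f).smul c) }
  have hcont : ∀ f : ℕ → testFunctions n' M', TendstoZero f →
      Tendsto (fun i => P.toLin (T (f i))) atTop (𝓝 0) := fun f hf => by
    obtain ⟨⟨K, hK, hfK⟩, -⟩ := id hf
    choose r e e' w w' hloc hx _ using fun x =>
      exists_localSubmersion hμ hμ' hp x isOpen_univ (mem_univ (p x))
    -- One finite family of cut-offs serves the whole sequence, because the supports lie in the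
    -- common compact set `K`.
    obtain ⟨t, χ, hχ, hχs, hχ1⟩ := exists_finite_cutoffs (n := n') hK (fun x => (e' x).source)
      (fun x => (e' x).open_source) hx
    have h1 : ∀ i, P.toLin (T (f i)) =
        ∑ x ∈ t, P.toLin (T (testMul (χ x) (hχ x) (f i))) := fun i => by
      conv_lhs => rw [← sum_testMul_eq hχ hχ1 (f i) (hfK i)]
      rw [map_sum, map_sum]
    simp only [h1]
    rw [← Finset.sum_const_zero (s := t) (ι := M')]
    refine tendsto_finsetSum _ fun x _ => P.tendsto_zero _ ?_
    choose g hgs _ hgf _ hg using fun i =>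
      (hloc x).exists_fiberIntegral (testMul (χ x) (hχ x) (f i))
        ((tsupport_testMul_subset _ _ _).trans (inter_subset_left.trans (hχs x)))
    have h2 : (fun i => T (testMul (χ x) (hχ x) (f i))) = g := funext fun i =>
      (hG _).unique fun u => hg i u u.2.1.continuous.continuousOn
    rw [h2]
    exact TendstoZero.fiberIntegral (hloc x) hf (hχ x) (hχs x) hgs hgf
  refine ⟨⟨P.toLin ∘ₗ T, hcont⟩, fun f => ⟨G f, hG f, rfl⟩, fun P' hP' => ?_⟩
  have h3 : P'.toLin = P.toLin ∘ₗ T := LinearMap.ext fun f => hP'.apply_eq hμ (hG f)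
  cases P'
  congr

/-- A test function supported in `p⁻¹(U)` has its fibre integral supported in `U`. -/
theorem IsPullback.support_subset (hμ : IsSmoothDensity n μ) (hμ' : IsSmoothDensity n' μ')
    (hp : Manifold.IsSubmersion (𝓡 n') (𝓡 n) ∞ p) {P : Distr n M} {P' : Distr n' M'}
    (h : IsPullback μ μ' p P P') : P'.support ⊆ p ⁻¹' P.support := by
  intro x hx U hU
  obtain ⟨f, hf, hf0⟩ := hx (p ⁻¹' U) (hp.contMDiff.continuous.continuousAt.preimage_mem_nhds hU)
  obtain ⟨g, hg, hgs⟩ := exists_isFiberIntegral hμ hμ' hp f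
  refine ⟨g, hgs.trans (image_subset_iff.2 hf), ?_⟩
  rwa [← h.apply_eq hμ hg]

omit [T2Space M'] [SecondCountableTopology M'] in
/-- The pull-back of a distribution that is smooth on `U` is smooth on the inverse image of `U`. -/
theorem IsPullback.isSmoothOn (hμ : IsSmoothDensity n μ) (hμ' : IsSmoothDensity n' μ')
    (hp : Manifold.IsSubmersion (𝓡 n') (𝓡 n) ∞ p) {P : Distr n M} {P' : Distr n' M'}
    (h : IsPullback μ μ' p P P') {V : Set M}
    (hP : ∀ x ∉ V, ∃ U κ, IsOpen U ∧ x ∈ U ∧ IsSmoothOn μ P U κ) :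
    ∀ x ∉ p ⁻¹' V, ∃ U κ, IsOpen U ∧ x ∈ U ∧ IsSmoothOn μ' P' U κ := by
  intro x hx
  obtain ⟨U, κ, hU, hxU, hκ, hPκ⟩ := hP (p x) hx
  obtain ⟨r, e, e', w, w', hloc, hxe', heU⟩ := exists_localSubmersion hμ hμ' hp x hU hxU
  refine ⟨e'.source, fun y => κ (p y), e'.open_source, hxe', ?_, fun f hf => ?_⟩
  · exact hκ.comp hp.contMDiff.contMDiffOn fun y hy => heU (hloc.mapsTo y hy)
  · obtain ⟨g, -, hge, -, -, hg⟩ := hloc.exists_fiberIntegral f hf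
    rw [h.apply_eq hμ (g := g) fun u => hg u u.2.1.continuous.continuousOn,
      hPκ g (hge.trans heU), hg κ (hκ.continuousOn.mono heU)]

end Global

/-! ## Lifting adapted charts -/

/-- Exchange of the last two factors of a product. -/
def prodRightComm (X Y Z : Type*) [NormedAddCommGroup X] [NormedSpace ℝ X]
    [NormedAddCommGroup Y] [NormedSpace ℝ Y] [NormedAddCommGroup Z] [NormedSpace ℝ Z] :
    ((X × Y) × Z) ≃L[ℝ] ((X × Z) × Y) where
  toFun q := ((q.1.1, q.2), q.1.2)
  invFun q := ((q.1.1, q.2), q.1.2)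
  left_inv _ := rfl
  right_inv _ := rfl
  map_add' _ _ := rfl
  map_smul' _ _ := rfl
  continuous_toFun := by fun_prop
  continuous_invFun := by fun_prop

theorem measurePreserving_prodRightComm {X Y Z : Type*}
    [NormedAddCommGroup X] [NormedSpace ℝ X] [MeasurableSpace X]
    [NormedAddCommGroup Y] [NormedSpace ℝ Y] [MeasurableSpace Y]
    [NormedAddCommGroup Z] [NormedSpace ℝ Z] [MeasurableSpace Z]
    (a : Measure X) (b : Measure Y) (c : Measure Z) [SFinite a] [SFinite b] [SFinite c] :
    MeasurePreserving (prodRightComm X Y Z) ((a.prod b).prod c) ((a.prod c).prod b) := by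
  have h1 := measurePreserving_prodAssoc a b c
  have h2 : MeasurePreserving (Prod.map id Prod.swap) (a.prod (b.prod c)) (a.prod (c.prod b)) :=
    (MeasurePreserving.id a).prod Measure.measurePreserving_swap
  have h3 := (measurePreserving_prodAssoc a c b).symm
  exact h3.comp (h2.comp h1)

/-- A linear isomorphism preserves measures, up to the choice of the Haar measure of the second
factor. -/
theorem exists_measurePreserving_prod {X Y Z : Type*}
    [NormedAddCommGroup X] [NormedSpace ℝ X] [FiniteDimensional ℝ X] [MeasureSpace X] [BorelSpace X]
    [NormedAddCommGroup Y] [NormedSpace ℝ Y] [FiniteDimensional ℝ Y] [MeasureSpace Y] [BorelSpace Y]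
    [NormedAddCommGroup Z] [NormedSpace ℝ Z] [FiniteDimensional ℝ Z] [MeasureSpace Z] [BorelSpace Z]
    [(volume : Measure X).IsAddHaarMeasure] [(volume : Measure Y).IsAddHaarMeasure]
    [(volume : Measure Z).IsAddHaarMeasure] (S : (X × Y) ≃L[ℝ] Z) :
    ∃ ν : Measure Y, ν.IsAddHaarMeasure ∧ MeasurePreserving S (volume.prod ν) volume := by
  have : (Measure.map S (volume : Measure (X × Y))).IsAddHaarMeasure :=
    S.isAddHaarMeasure_map volume
  set β : NNReal := (volume : Measure Z).addHaarScalarFactor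
    (Measure.map S (volume : Measure (X × Y))) with hβ
  have hβ0 : 0 < β := Measure.addHaarScalarFactor_pos_of_isAddHaarMeasure _ _
  have hvol : (volume : Measure Z) = β • Measure.map S (volume : Measure (X × Y)) :=
    Measure.isAddLeftInvariant_eq_smul _ _
  refine ⟨(β : ENNReal) • volume, Measure.IsAddHaarMeasure.smul _
    (by exact_mod_cast hβ0.ne') ENNReal.coe_ne_top, S.continuous.measurable, ?_⟩
  rw [Measure.prod_smul_right, Measure.map_smul, hvol]
  rfl

section Lift

variable {n n' : ℕ} {M M' : Type*}
  [TopologicalSpace M] [ChartedSpace (Euc n) M]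
  [TopologicalSpace M'] [ChartedSpace (Euc n') M'] [MeasurableSpace M']

/-- An adapted chart of the total space of a submersion in which the submersion is, up to the linear
isomorphism `S` of the coordinates along the submanifold, the projection to the coordinates of
the adapted chart `e` of the base. -/
structure AdaptedLift (n' : ℕ) [ChartedSpace (Euc n') M'] (μ' : Measure M') (p : M' → M) {V : Set M}
    {d k : ℕ} (e : AdaptedChart n V d k) where
  {d' r : ℕ}
  S : (Euc d × Euc r) ≃L[ℝ] Euc d'
  ν : Measure (Euc r)
  w' : Euc d' × Euc k → ℝ
  e' : AdaptedChart n' (p ⁻¹' V) d' k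
  isAddHaarMeasure : ν.IsAddHaarMeasure
  measurePreserving : MeasurePreserving S (volume.prod ν) volume
  density : HasDensityInChart μ' e'.chart w'
  mapsTo : ∀ y ∈ e'.chart.source, p y ∈ e.chart.source
  fst_eq : ∀ y ∈ e'.chart.source, (S.symm (e'.chart y).1).1 = (e.chart (p y)).1
  snd_eq : ∀ y ∈ e'.chart.source, (e'.chart y).2 = (e.chart (p y)).2

theorem AdaptedChart.add_eq [IsManifold (𝓡 n) ∞ M] {V : Set M} {d k : ℕ}
    (e : AdaptedChart n V d k) {y : M} (hy : y ∈ e.chart.source) : d + k = n := by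
  have : IsManifold (𝓡 n) 1 M := IsManifold.of_le (n := ∞) (by simp)
  have h : Module.finrank ℝ (Euc n) = Module.finrank ℝ (Euc d × Euc k) :=
    (e.mdiff.mfderiv hy).toLinearEquiv.finrank_eq
  simpa using h.symm

/-- The lifted chart has coordinates `((x, u), h)`, which `R` rearranges as `(S(x, h), u)`. The
coordinate `u` is unchanged, so the slice `{u = 0}` is `p⁻¹(V)`. `S` is chosen by dimension alone,
and `ν` corrects its effect on volume. -/
theorem exists_adaptedLift [IsManifold (𝓡 n) ∞ M] [IsManifold (𝓡 n') ∞ M'] [BorelSpace M']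
    {μ' : Measure M'} {p : M' → M}
    (hμ' : IsSmoothDensity n' μ') (hp : Manifold.IsSubmersion (𝓡 n') (𝓡 n) ∞ p)
    {V : Set M} {d k : ℕ} (e : AdaptedChart n V d k) {x : M'} (hx : p x ∈ e.chart.source) :
    ∃ l : AdaptedLift n' μ' p e, x ∈ l.e'.chart.source := by
  obtain ⟨r, e₀, hr, he₀, hxe₀, hsub, hproj⟩ := exists_chart_lift hp e.smooth (x := x) hx
    (chartAt (Euc n') x).open_source (mem_chart_source _ x)
  have hdk := e.add_eq hx
  have hS : Module.finrank ℝ (Euc d × Euc r) = Module.finrank ℝ (Euc (d + r)) := by simp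
  set S : (Euc d × Euc r) ≃L[ℝ] Euc (d + r) := ContinuousLinearEquiv.ofFinrankEq hS with hSdef
  obtain ⟨ν, hν, hSν⟩ := exists_measurePreserving_prod S
  set R : ((Euc d × Euc k) × Euc r) ≃L[ℝ] (Euc (d + r) × Euc k) :=
    (prodRightComm (Euc d) (Euc k) (Euc r)).trans
      (S.prodCongr (ContinuousLinearEquiv.refl ℝ (Euc k))) with hR
  set e₁ : OpenPartialHomeomorph M' (Euc (d + r) × Euc k) :=
    e₀.trans R.toHomeomorph.toOpenPartialHomeomorph with he₁
  have hsrc : e₁.source = e₀.source := by simp [he₁]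
  have he₁s : IsSmoothChart n' e₁ := he₀.trans R.contDiff.contDiffOn R.symm.contDiff.contDiffOn
  have hval : ∀ y, e₁ y = (S ((e₀ y).1.1, (e₀ y).2), (e₀ y).1.2) := fun y => rfl
  have hL : Module.finrank ℝ (Euc (d + r) × Euc k) = Module.finrank ℝ (Euc n') := by
    simp only [Module.finrank_prod, finrank_euclideanSpace, Fintype.card_fin]
    omega
  obtain ⟨w', hw'⟩ := hμ'.exists_hasDensityInChart he₁s x (hsrc ▸ hsub)
    (ContinuousLinearEquiv.ofFinrankEq hL)
  have hmaps : ∀ y ∈ e₁.source, p y ∈ e.chart.source := fun y hy => (hproj y (hsrc ▸ hy)).1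
  have hsnd : ∀ y ∈ e₁.source, (e₁ y).2 = (e.chart (p y)).2 := fun y hy => by
    rw [hval, ← (hproj y (hsrc ▸ hy)).2]
  refine ⟨{ S := S, ν := ν, w' := w', e' := ⟨e₁, he₁s, fun y hy => ?_⟩, isAddHaarMeasure := hν,
            measurePreserving := hSν, density := hw', mapsTo := hmaps, fst_eq := fun y hy => ?_,
            snd_eq := hsnd }, hsrc.symm ▸ hxe₀⟩
  · rw [hsnd y hy]
    exact e.mem_iff (p y) (hmaps y hy)
  · rw [← (hproj y (hsrc ▸ hy)).2]
    change (S.symm (e₁ y).1).1 = _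
    rw [hval, S.symm_apply_apply]

namespace AdaptedLift

variable {μ' : Measure M'} {p : M' → M} {V : Set M} {d k : ℕ} {e : AdaptedChart n V d k}

theorem localSubmersion [MeasurableSpace M] (l : AdaptedLift n' μ' p e) {μ : Measure M}
    (hp : Continuous p) {w : Euc d × Euc k → ℝ} (hw : HasDensityInChart μ e.chart w) :
    LocalSubmersion (n := n) (n' := n') μ μ' p e.chart l.e'.chart
      ((l.S.symm.prodCongr (ContinuousLinearEquiv.refl ℝ (Euc k))).trans
        (prodRightComm (Euc d) (Euc l.r) (Euc k))) l.ν w l.w' where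
  continuous := hp
  smooth := e.smooth
  smooth' := l.e'.smooth
  density := hw
  density' := l.density
  measurePreserving := by
    have := l.isAddHaarMeasure
    have h1 : MeasurePreserving l.S.symm volume ((volume : Measure (Euc d)).prod l.ν) :=
      MeasurePreserving.symm l.S.toHomeomorph.toMeasurableEquiv l.measurePreserving
    exact (measurePreserving_prodRightComm volume l.ν volume).comp
      (h1.prod (MeasurePreserving.id volume))
  mapsTo := l.mapsTo
  fst_eq y hy := Prod.ext (l.fst_eq y hy) (l.snd_eq y hy)

/-- The projection of the coordinates along the submanifold. -/
def proj (l : AdaptedLift n' μ' p e) : Euc l.d' →L[ℝ] Euc d :=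
  (ContinuousLinearMap.fst ℝ (Euc d) (Euc l.r)).comp (l.S.symm : Euc l.d' →L[ℝ] Euc d × Euc l.r)

/-- The total symbol of the pull-back of a conormal distribution. -/
theorem hasTotalSymbol [T2Space M] [MeasurableSpace M] [BorelSpace M] [BorelSpace M']
    (l : AdaptedLift n' μ' p e) {μ : Measure M} (hμ : IsSmoothDensity n μ)
    (hp : ContMDiff (𝓡 n') (𝓡 n) ∞ p) {P : Distr n M}
    {P' : Distr n' M'} (hP : IsPullback μ μ' p P P') {m : ℂ} {a : Euc d → Euc k → ℂ}
    {A : ℕ → Euc d → Euc k → ℂ} (h : HasTotalSymbol m μ P e a A) :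
    HasTotalSymbol m μ' P' l.e' (fun x => a (l.proj x)) (fun j x => A j (l.proj x)) := by
  obtain ⟨ha, w, κ, hw, hκ, hPf⟩ := h
  have := l.isAddHaarMeasure
  refine ⟨ha.comp_clm l.proj, l.w', fun y => κ (p y), l.density,
    hκ.comp hp.contMDiffOn l.mapsTo, fun f hf => ?_⟩
  have hloc := l.localSubmersion hp.continuous hw
  obtain ⟨g, -, hge, -, hgd, hg⟩ := hloc.exists_fiberIntegral f hf
  rw [hP.apply_eq hμ (g := g) fun u => hg u u.2.1.continuous.continuousOn, hPf g hge,
    hg κ hκ.continuousOn]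
  -- The integrals of the smooth remainders already agree by `hg`; only the oscillatory parts are
  -- left.
  congr 1
  change symbolPairing a (chartDensity e.chart w g) =
    symbolPairing _ (chartDensity l.e'.chart l.w' f)
  rw [hgd]
  exact symbolPairing_partialIntegral l.ν l.S l.measurePreserving ha.smooth.continuous
    ha.exists_norm_le (chartDensity_spec l.e'.smooth l.density f hf).1
    (hasCompactSupport_chartDensity l.e'.smooth l.density f hf)

end AdaptedLift

end Lift

/-! ## The normal bundle of the inverse image -/

section NormalBundle

variable {n n' : ℕ} {M M' : Type*}
  [TopologicalSpace M] [ChartedSpace (Euc n) M] [IsManifold (𝓡 n) ∞ M]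
  [TopologicalSpace M'] [ChartedSpace (Euc n') M'] [IsManifold (𝓡 n') ∞ M']
  {p : M' → M} {V : Set M} {d d' k : ℕ}

theorem AdaptedChart.normalTriv_mk (e : AdaptedChart n V d k) {y : M} (hy : y ∈ e.chart.source)
    (hV : y ∈ V) (v : TangentSpace (𝓡 n) y) :
    e.normalTriv y hy hV (Submodule.Quotient.mk v) = e.dNormal y v := rfl

omit [IsManifold (𝓡 n) ∞ M] [IsManifold (𝓡 n') ∞ M'] in
theorem contDiffOn_chart_comp {V' : Set M'} (hp : ContMDiff (𝓡 n') (𝓡 n) ∞ p)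
    (e : AdaptedChart n V d k) (e' : AdaptedChart n' V' d' k) :
    ContDiffOn ℝ ∞ (fun z => e.chart (p (e'.chart.symm z)))
      (e'.chart.target ∩ e'.chart.symm ⁻¹' (p ⁻¹' e.chart.source)) :=
  contMDiffOn_iff_contDiffOn.1 (e.smooth.contMDiffOn.comp
    (hp.comp_contMDiffOn (e'.smooth.contMDiffOn_symm.mono inter_subset_left)) fun _ hz => hz.2)

omit [IsManifold (𝓡 n) ∞ M] [IsManifold (𝓡 n') ∞ M'] in
theorem isOpen_chart_comp {V' : Set M'} (hp : Continuous p)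
    (e : AdaptedChart n V d k) (e' : AdaptedChart n' V' d' k) :
    IsOpen (e'.chart.target ∩ e'.chart.symm ⁻¹' (p ⁻¹' e.chart.source)) :=
  e'.chart.isOpen_inter_preimage_symm (e.chart.open_source.preimage hp)

omit [IsManifold (𝓡 n) ∞ M] [IsManifold (𝓡 n') ∞ M'] in
theorem mem_chart_comp {V' : Set M'} (e : AdaptedChart n V d k) (e' : AdaptedChart n' V' d' k)
    {x : M'} (hx : x ∈ e'.chart.source) (hpx : p x ∈ e.chart.source) :
    e'.chart x ∈ e'.chart.target ∩ e'.chart.symm ⁻¹' (p ⁻¹' e.chart.source) := by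
  refine ⟨e'.chart.map_source hx, ?_⟩
  rw [mem_preimage, e'.chart.left_inv hx]
  exact hpx

omit [IsManifold (𝓡 n) ∞ M] [IsManifold (𝓡 n') ∞ M'] in
theorem dNormal_mfderiv {V' : Set M'} (hp : ContMDiff (𝓡 n') (𝓡 n) ∞ p)
    (e : AdaptedChart n V d k) (e' : AdaptedChart n' V' d' k) {x : M'}
    (hx : x ∈ e'.chart.source) (hpx : p x ∈ e.chart.source) (v : TangentSpace (𝓡 n') x) :
    e.dNormal (p x) (mfderiv (𝓡 n') (𝓡 n) p x v) =
      (fderiv ℝ (fun z => e.chart (p (e'.chart.symm z))) (e'.chart x)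
        (mfderiv (𝓡 n') 𝓘(ℝ, Euc d' × Euc k) e'.chart x v)).2 := by
  set h : Euc d' × Euc k → Euc d × Euc k := fun z => e.chart (p (e'.chart.symm z)) with hh
  have hd : DifferentiableAt ℝ h (e'.chart x) :=
    ((contDiffOn_chart_comp hp e e').contDiffAt ((isOpen_chart_comp hp.continuous e e').mem_nhds
      (mem_chart_comp e e' hx hpx))).differentiableAt (by simp)
  have h1 := (hd.hasFDerivAt.hasMFDerivAt).comp x (e'.mdiff.mdifferentiableAt hx).hasMFDerivAt
  have h2 := (e.mdiff.mdifferentiableAt hpx).hasMFDerivAt.comp x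
    ((hp x).mdifferentiableAt (by simp)).hasMFDerivAt
  have h3 : e.chart ∘ p =ᶠ[𝓝 x] h ∘ e'.chart := by
    filter_upwards [e'.chart.open_source.mem_nhds hx] with y hy
    simp [hh, e'.chart.left_inv hy]
  have h4 := h2.mfderiv.symm.trans (h1.congr_of_eventuallyEq h3).mfderiv
  exact congrArg (fun T => (T v : Euc d × Euc k).2) h4

section Adapted

variable [MeasurableSpace M'] {μ' : Measure M'} {e : AdaptedChart n V d k}

omit [IsManifold (𝓡 n) ∞ M] [IsManifold (𝓡 n') ∞ M'] in
-- This is the differential of the identity `e'₂ = e₂ ∘ p` between transverse coordinates.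
theorem AdaptedLift.dNormal_eq (l : AdaptedLift n' μ' p e) (hp : ContMDiff (𝓡 n') (𝓡 n) ∞ p)
    {x : M'} (hx : x ∈ l.e'.chart.source) (v : TangentSpace (𝓡 n') x) :
    e.dNormal (p x) (mfderiv (𝓡 n') (𝓡 n) p x v) = l.e'.dNormal x v := by
  rw [dNormal_mfderiv hp e l.e' hx (l.mapsTo x hx)]
  set h : Euc l.d' × Euc k → Euc d × Euc k := fun z => e.chart (p (l.e'.chart.symm z)) with hh
  have hd : DifferentiableAt ℝ h (l.e'.chart x) :=
    ((contDiffOn_chart_comp hp e l.e').contDiffAt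
      ((isOpen_chart_comp hp.continuous e l.e').mem_nhds
      (mem_chart_comp e l.e' hx (l.mapsTo x hx)))).differentiableAt (by simp)
  have h1 : HasFDerivAt (fun z => (h z).2) _ (l.e'.chart x) :=
    (hasFDerivAt_snd (p := h (l.e'.chart x))).comp (l.e'.chart x) hd.hasFDerivAt
  have h2 : (fun z => (h z).2) =ᶠ[𝓝 (l.e'.chart x)] Prod.snd := by
    filter_upwards [l.e'.chart.open_target.mem_nhds (l.e'.chart.map_source hx)] with z hz
    rw [hh]
    simp only
    rw [← l.snd_eq _ (l.e'.chart.map_target hz), l.e'.chart.right_inv hz]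
  have h3 := h1.unique (hasFDerivAt_snd.congr_of_eventuallyEq h2)
  exact congrArg (fun T => T (mfderiv (𝓡 n') 𝓘(ℝ, Euc l.d' × Euc k) l.e'.chart x v)) h3

variable (l : AdaptedLift n' μ' p e) (hp : ContMDiff (𝓡 n') (𝓡 n) ∞ p)
include hp

theorem AdaptedLift.exists_normalEquiv {x : M'} (hx : x ∈ l.e'.chart.source) (hV : x ∈ p ⁻¹' V) :
    ∃ Φ : NormalSpace n' (p ⁻¹' V) x ≃ₗ[ℝ] NormalSpace n V (p x),
      ∀ v : TangentSpace (𝓡 n') x, Φ (Submodule.Quotient.mk v) =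
        Submodule.Quotient.mk (mfderiv (𝓡 n') (𝓡 n) p x v) := by
  refine ⟨(l.e'.normalTriv x hx hV).trans (e.normalTriv (p x) (l.mapsTo x hx) hV).symm,
    fun v => ?_⟩
  rw [LinearEquiv.trans_apply, LinearEquiv.symm_apply_eq, AdaptedChart.normalTriv_mk,
    AdaptedChart.normalTriv_mk, l.dNormal_eq hp hx]

variable {Φ : ∀ x : ↥(p ⁻¹' V), NormalSpace n' (p ⁻¹' V) (x : M') ≃ₗ[ℝ] NormalSpace n V (p x)}
  (hΦ : ∀ (x : ↥(p ⁻¹' V)) (v : TangentSpace (𝓡 n') (x : M')),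
    Φ x (Submodule.Quotient.mk v) =
      Submodule.Quotient.mk (mfderiv (𝓡 n') (𝓡 n) p (x : M') v))
include hΦ

/-- In a chart and its lift, `Φ` is the identity matrix; the agreement of frame volumes and of
covectors rests on this. -/
theorem AdaptedLift.normalTriv_apply (x : ↥(p ⁻¹' V)) (hx : (x : M') ∈ l.e'.chart.source)
    (v : NormalSpace n' (p ⁻¹' V) (x : M')) :
    e.normalTriv (p x) (l.mapsTo x hx) x.2 (Φ x v) = l.e'.normalTriv x hx x.2 v := by
  obtain ⟨v, rfl⟩ := Submodule.Quotient.mk_surjective _ v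
  rw [hΦ, AdaptedChart.normalTriv_mk, AdaptedChart.normalTriv_mk, l.dNormal_eq hp hx]

theorem AdaptedLift.frameVolume_eq (x : ↥(p ⁻¹' V)) (hx : (x : M') ∈ l.e'.chart.source)
    (b : Fin k → NormalSpace n' (p ⁻¹' V) (x : M')) :
    e.frameVolume (p x) (l.mapsTo x hx) x.2 (fun i => Φ x (b i)) =
      l.e'.frameVolume x hx x.2 b := by
  simp only [AdaptedChart.frameVolume, l.normalTriv_apply hp hΦ x hx]

theorem AdaptedLift.covector_eq (x : ↥(p ⁻¹' V)) (hx : (x : M') ∈ l.e'.chart.source) (ξ : Euc k) :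
    l.e'.covector x hx x.2 ξ ∘ₗ (Φ x).symm.toLinearMap =
      e.covector (p x) (l.mapsTo x hx) x.2 ξ := by
  refine LinearMap.ext fun v => ?_
  have h := l.normalTriv_apply hp hΦ x hx ((Φ x).symm v)
  rw [LinearEquiv.apply_symm_apply] at h
  simp only [AdaptedChart.covector, LinearMap.comp_apply, LinearEquiv.coe_coe]
  rw [h]

end Adapted

/-- The isomorphism of normal bundles induced by the differential of a submersion is smooth. -/
theorem isSmoothNormalIso (hp : ContMDiff (𝓡 n') (𝓡 n) ∞ p)
    {Φ : ∀ x : ↥(p ⁻¹' V), NormalSpace n' (p ⁻¹' V) (x : M') ≃ₗ[ℝ] NormalSpace n V (p x)}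
    (hΦ : ∀ (x : ↥(p ⁻¹' V)) (v : TangentSpace (𝓡 n') (x : M')),
      Φ x (Submodule.Quotient.mk v) =
        Submodule.Quotient.mk (mfderiv (𝓡 n') (𝓡 n) p (x : M') v)) :
    IsSmoothNormalIso p V k Φ := by
  intro d d' e e'
  have : IsManifold (𝓡 n') 1 M' := IsManifold.of_le (n := ∞) (by simp)
  set h : Euc d' × Euc k → Euc d × Euc k := fun z => e.chart (p (e'.chart.symm z)) with hh
  set O := e'.chart.target ∩ e'.chart.symm ⁻¹' (p ⁻¹' e.chart.source) with hO
  -- Here `e'` need not be a lift of `e`, so the matrix of `Φ` is the block of transverse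
  -- derivatives of the transverse components of `p`.
  refine ⟨fun x => (ContinuousLinearMap.snd ℝ (Euc d) (Euc k)).comp
    ((fderiv ℝ h (e'.chart x)).comp (ContinuousLinearMap.inr ℝ (Euc d') (Euc k))), ?_, ?_⟩
  · have h1 : ContDiffOn ℝ ∞ (fderiv ℝ h) O :=
      (contDiffOn_chart_comp hp e e').fderiv_of_isOpen (isOpen_chart_comp hp.continuous e e')
        (by simp)
    have h2 : ContDiffOn ℝ ∞ (fun z => (ContinuousLinearMap.snd ℝ (Euc d) (Euc k)).comp
        ((fderiv ℝ h z).comp (ContinuousLinearMap.inr ℝ (Euc d') (Euc k)))) O :=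
      contDiffOn_const.clm_comp (h1.clm_comp contDiffOn_const)
    exact (contMDiffOn_iff_contDiffOn.2 h2).comp
      (e'.smooth.contMDiffOn.mono fun x hx => hx.2.1) fun x hx => mem_chart_comp e e' hx.2.1 hx.2.2
  · intro x hx hpx v
    obtain ⟨v, rfl⟩ := Submodule.Quotient.mk_surjective _ v
    rw [hΦ, AdaptedChart.normalTriv_mk, AdaptedChart.normalTriv_mk, dNormal_mfderiv hp e e' hx hpx]
    set u : Euc d' × Euc k := mfderiv (𝓡 n') 𝓘(ℝ, Euc d' × Euc k) e'.chart x v with hu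
    -- `v₁` is the part of `v` along the submanifold. Since `Φ` is defined on the quotient, `dp(v₁)`
    -- is tangent to `V` and contributes nothing to the normal component.
    obtain ⟨v₁, hv₁⟩ := e'.mdiff.mfderiv_surjective hx ((u.1, 0) : Euc d' × Euc k)
    have h1 : v₁ ∈ tangentSubspace n' (p ⁻¹' V) (x : M') := by
      rw [e'.tangentSubspace_eq_ker hx x.2, LinearMap.mem_ker]
      exact congrArg Prod.snd hv₁
    have h2 : e.dNormal (p x) (mfderiv (𝓡 n') (𝓡 n) p (x : M') v₁) = 0 := by
      have h3 := hΦ x v₁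
      rw [(Submodule.Quotient.mk_eq_zero _).2 h1, map_zero, eq_comm,
        Submodule.Quotient.mk_eq_zero, e.tangentSubspace_eq_ker hpx x.2] at h3
      exact h3
    rw [dNormal_mfderiv hp e e' hx hpx, hv₁] at h2
    have h4 : u = (u.1, 0) + ContinuousLinearMap.inr ℝ (Euc d') (Euc k) u.2 := by
      simp
    have h5 : (fderiv ℝ h (e'.chart x) u).2 =
        (fderiv ℝ h (e'.chart x) (u.1, 0)).2 +
          (fderiv ℝ h (e'.chart x) (ContinuousLinearMap.inr ℝ (Euc d') (Euc k) u.2)).2 := by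
      conv_lhs => rw [h4, map_add]
      rfl
    rw [h5, h2, zero_add]
    rfl

end NormalBundle

end ConormalPullback

end

/-! ### The main theorem, assembled from lifted charts. -/

open ConormalPullback in
theorem mainTheorem7 {n n' k : ℕ} {M M' : Type*}
    [TopologicalSpace M] [ChartedSpace (Euc n) M] [IsManifold (𝓡 n) ∞ M]
    [T2Space M] [SecondCountableTopology M] [MeasurableSpace M] [BorelSpace M]
    [TopologicalSpace M'] [ChartedSpace (Euc n') M'] [IsManifold (𝓡 n') ∞ M']
    [T2Space M'] [SecondCountableTopology M'] [MeasurableSpace M'] [BorelSpace M']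
    (μ : Measure M) (hμ : IsSmoothDensity n μ) (μ' : Measure M') (hμ' : IsSmoothDensity n' μ')
    (p : M' → M) (hp : Manifold.IsSubmersion (𝓡 n') (𝓡 n) ∞ p)
    (V : Set M) (hV : IsClosedSubmanifold n V k) :
    -- `p⁻¹(V)` is a closed submanifold, and the differential of `p` induces an isomorphism from
    -- its normal bundle to the pull-back of the normal bundle of `V`
    IsClosedSubmanifold n' (p ⁻¹' V) k ∧
    ∃ Φ : ∀ x : ↥(p ⁻¹' V), NormalSpace n' (p ⁻¹' V) (x : M') ≃ₗ[ℝ] NormalSpace n V (p x),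
      (∀ (x : ↥(p ⁻¹' V)) (v : TangentSpace (𝓡 n') (x : M')),
        Φ x (Submodule.Quotient.mk v) =
          Submodule.Quotient.mk (mfderiv (𝓡 n') (𝓡 n) p (x : M') v)) ∧
      IsSmoothNormalIso p V k Φ ∧
      -- the pull-back of distributions by `p` is well defined
      (∀ P : Distr n M, ∃! P' : Distr n' M', IsPullback μ μ' p P P') ∧
      -- the pull-back of a conormal distribution
      ∀ (m : ℂ) (P : Distr n M) (P' : Distr n' M'),
        IsConormalC m μ V k P → IsPullback μ μ' p P P' →
        IsConormal m μ' (p ⁻¹' V) k P' ∧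
        (IsCompact (p ⁻¹' P.support) → IsConormalC m μ' (p ⁻¹' V) k P') ∧
        -- its principal symbol
        ∀ ρ : ∀ y : V, (Fin k → NormalSpace n V (y : M)) → ℝ, IsNormalDensity n V k ρ →
          IsNormalDensity n' (p ⁻¹' V) k (fun x b => ρ ⟨p x, x.2⟩ fun i => Φ x (b i)) ∧
          ∀ σ : ∀ y : V, Module.Dual ℝ (NormalSpace n V (y : M)) → ℂ,
            HasPrincipalSymbol m μ V k ρ P σ →
            HasPrincipalSymbol m μ' (p ⁻¹' V) k (fun x b => ρ ⟨p x, x.2⟩ fun i => Φ x (b i)) P'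
              (fun x η => σ ⟨p x, x.2⟩ (η ∘ₗ (Φ x).symm.toLinearMap)) := by
  have hps : ContMDiff (𝓡 n') (𝓡 n) ∞ p := hp.contMDiff
  have hlift : ∀ {d : ℕ} (e : AdaptedChart n V d k) {x : M'}, p x ∈ e.chart.source →
      ∃ l : AdaptedLift n' μ' p e, x ∈ l.e'.chart.source := fun e _ hx =>
    exists_adaptedLift hμ' hp e hx
  refine ⟨⟨hV.1.preimage hps.continuous, fun x hx => ?_⟩, ?_⟩
  · obtain ⟨d, e, he⟩ := hV.2 (p x) hx
    obtain ⟨l, hl⟩ := hlift e he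
    exact ⟨l.d', l.e', hl⟩
  have hΦ : ∀ x : ↥(p ⁻¹' V), ∃ Φ : NormalSpace n' (p ⁻¹' V) (x : M') ≃ₗ[ℝ] NormalSpace n V (p x),
      ∀ v : TangentSpace (𝓡 n') (x : M'), Φ (Submodule.Quotient.mk v) =
        Submodule.Quotient.mk (mfderiv (𝓡 n') (𝓡 n) p (x : M') v) := fun x => by
    obtain ⟨d, e, he⟩ := hV.2 (p x) x.2
    obtain ⟨l, hl⟩ := hlift e he
    exact l.exists_normalEquiv hps hl x.2
  choose Φ hΦ using hΦ
  refine ⟨Φ, hΦ, isSmoothNormalIso hps hΦ, existsUnique_isPullback hμ hμ' hp, ?_⟩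
  intro m P P' hP hPP'
  have hoff := hPP'.isSmoothOn hμ hμ' hp hP.1.1
  have hcon : IsConormal m μ' (p ⁻¹' V) k P' := by
    refine ⟨hoff, fun x hx => ?_⟩
    obtain ⟨d, e, a, A, he, ha⟩ := hP.1.2 (p x) hx
    obtain ⟨l, hl⟩ := hlift e he
    exact ⟨l.d', l.e', _, _, hl, l.hasTotalSymbol hμ hps hPP' ha⟩
  refine ⟨hcon, fun hK => ⟨hcon, hK.of_isClosed_subset (isClosed_support P')
    (hPP'.support_subset hμ hμ' hp)⟩, fun ρ hρ => ⟨fun x => ?_, fun σ hσ => ⟨hoff, fun x hx => ?_⟩⟩⟩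
  · obtain ⟨d, e, r, he, hr, hr0, hρr⟩ := hρ ⟨p x, x.2⟩
    obtain ⟨l, hl⟩ := hlift e he
    refine ⟨l.d', l.e', fun y => r (p y), hl, hr.comp hps.contMDiffOn l.mapsTo,
      fun y hy => hr0 _ (l.mapsTo y hy), fun y hy b => ?_⟩
    beta_reduce
    rw [hρr ⟨p y, y.2⟩ (l.mapsTo y hy), l.frameVolume_eq hps hΦ y hy]
  · obtain ⟨d, e, a, A, he, ha, hσa⟩ := hσ.2 (p x) hx
    obtain ⟨l, hl⟩ := hlift e he
    refine ⟨l.d', l.e', _, _, hl, l.hasTotalSymbol hμ hps hPP' ha, fun y hy ξ hξ b => ?_⟩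
    -- The symbol identity downstairs is tested on the frame transported by `Φ`; frame volumes,
    -- covectors and leading terms then match one by one.
    have h := hσa ⟨p y, y.2⟩ (l.mapsTo y hy) ξ hξ fun i => Φ y (b i)
    rw [l.frameVolume_eq hps hΦ y hy] at h
    have hfst : l.proj (l.e'.chart y).1 = (e.chart (p y)).1 := l.fst_eq y hy
    beta_reduce
    rw [l.covector_eq hps hΦ y hy, h, hfst]
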